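/- **Model.** A base station (BS) sits at the origin of $\mathbb{R}^2$, and the content servers form a homogeneous Poisson point process of density $\lambda_c>0$. $\mathrm{CS}_n$ is the $n$-th nearest server, $r_n$ its distance to the BS, and $z_n=r_n^{-\alpha}$ its channel gain, with path loss exponent $\alpha>0$. Fix the transmit SNR $\rho>0$, an index $t\ge1$, a number $M_s\ge 2$ of files $f_1,\dots,f_{M_s}$ with target rates $R_l>0$, put $\epsilon_l=2^{R_l}-1$, and fix constants $\beta_2,\dots,\beta_{M_s}$ with $\sum_{j=2}^{M_s}\beta_j=1$. The BS sends a superposition of the $M_s$ files with power coefficients $$\alpha_1^2=\min\Big\{1,\frac{\epsilon_1(\rho z_t+1)}{\rho(1+\epsilon_1)z_t}\Big\},\qquad \alpha_j^2=\beta_jP_r\ (j\ge2),\qquad P_r=\max\Big\{0,\frac{\rho z_t-\epsilon_1}{\rho(1+\epsilon_1)z_t}\Big\}.$$ Files are decoded by successive interference cancellation: $\mathrm{CS}_m$ decodes $f_i$ if $\log_2\Big(1+\dfrac{\rho\alpha_j^2z_m}{\rho z_m\sum_{k=j+1}^{M_s}\alpha_k^2+1}\Big)\ge R_j$ for all $1\le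 j\le i$. Let $\mathrm{P}_{m,i}$ be the outage probability, i.e. the probability that $\mathrm{CS}_m$ does not decode $f_i$. Put $\bar\xi_i=\beta_i-\epsilon_i\sum_{j=i+1}^{M_s}\beta_j$ for $2\le i\le M_s$ (so $\bar\xi_{M_s}=\beta_{M_s}$), $\phi_i=\min\{\bar\xi_2/\epsilon_2,\dots,\bar\xi_i/\epsilon_i\}$, and assume $\bar\xi_i>0$ for all $2\le i\le M_s$. **Lemma 2.** Assume $\epsilon_{M_s}\ge\epsilon_1$. 1. For $1\le n\le t$, $$\mathrm{P}_{n,1}=e^{-\lambda_c\pi(\rho/\epsilon_1)^{2/\alpha}}\sum_{k=0}^{n-1}\frac{(\lambda_c\pi)^k(\rho/\epsilon_1)^{2k/\alpha}}{k!}.$$ 2. For $2\le i\le M_s$, with $\theta_i=\frac{\epsilon_1}{\rho}+\frac{1+\epsilon_1}{\rho\phi_i}$, $$\mathrm{P}_{t,i}=e^{-\lambda_c\pi\theta_i^{-2/\alpha}}\sum_{k=0}^{t-1}\frac{(\lambda_c\pi)^k\theta_i^{-2k/\alpha}}{k!}.$$ 3. Let $1\le m<t$, $2\le i\le M_s$,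 $\tau_1=\Big(\frac{\rho\phi_i}{1+\epsilon_1+\epsilon_1\phi_i}\Big)^{1/\alpha}$, $\tau_2=(\epsilon_1/\rho)^{-1/\alpha}$, $g(y)=\Big(\frac{1+\epsilon_1}{\phi_i(\rho-\epsilon_1y^\alpha)}\Big)^{-1/\alpha}$ (with $g(\tau_2)=0$), $$f_{r_m,r_t}(x,y)=4y(\lambda_c\pi)^te^{-\lambda_c\pi y^2}\frac{x^{2m-1}(y^2-x^2)^{t-m-1}}{(t-m-1)!\,(m-1)!},$$ and, for $0\le p\le t-m-1$, $$f_{m,p}(y)=\frac{e^{-\lambda_c\pi y^2}y^{2(t-m-1)-2p+1}}{2m+2p}\big(y^{2m+2p}-g(y)^{2m+2p}\big).$$ Then each $f_{m,p}$ is integrable on $[\tau_1,\tau_2]$, $$\mathrm{P}_{m,i}=\mathrm{P}_{t,1}+\int_{\tau_1}^{\tau_2}\!\int_{g(y)}^{y}f_{r_m,r_t}(x,y)\,dx\,dy=\mathrm{P}_{t,1}+\frac{4(\lambda_c\pi)^t}{(t-m-1)!(m-1)!}\sum_{p=0}^{t-m-1}(-1)^p\binom{t-m-1}{p}\int_{\tau_1}^{\tau_2}f_{m,p}(y)\,dy,$$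 and the $N$-point Chebyshev–Gauss approximation of this expression, with $w_l=\cos\big(\frac{2l-1}{2N}\pi\big)$, converges to it: $$\mathrm{P}_{m,i}=\lim_{N\to\infty}\Big[\mathrm{P}_{t,1}+\frac{4(\lambda_c\pi)^t}{(t-m-1)!(m-1)!}\sum_{p=0}^{t-m-1}(-1)^p\binom{t-m-1}{p}\sum_{l=1}^{N}\frac{\pi(\tau_2-\tau_1)}{2N}f_{m,p}\Big(\frac{\tau_2-\tau_1}{2}w_l+\frac{\tau_2+\tau_1}{2}\Big)\sqrt{1-w_l^2}\Big].$$ -/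

import Mathlib

open MeasureTheory ProbabilityTheory Filter Topology
open scoped Nat

noncomputable section

namespace ContentPush

/-- The Euclidean plane in which the content servers are deployed. -/
abbrev Plane : Type := EuclideanSpace ℝ (Fin 2)

/-- `Φ` is a homogeneous Poisson point process of density `lam` in the plane: the number of points
in a Borel set is a random variable, it is Poisson distributed with mean `lam * area` for every
bounded Borel set, and the numbers of points in finitely many pairwise disjoint bounded Borel sets
are independent. -/
structure IsHPPP {Ω : Type*} [MeasurableSpace Ω] (P : Measure Ω) (Φ : Ω → Set Plane)
    (lam : ℝ) : Prop where
  measurable_count : ∀ A : Set Plane, MeasurableSet A →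
    Measurable fun ω => (Φ ω ∩ A).encard
  law_count : ∀ A : Set Plane, MeasurableSet A → Bornology.IsBounded A →
    P.map (fun ω => (Φ ω ∩ A).encard) =
      (poissonMeasure (Real.toNNReal (lam * (volume : Measure Plane).real A))).map
        (fun k : ℕ => (k : ℕ∞))
  indep_count : ∀ (n : ℕ) (A : Fin n → Set Plane),
    (∀ k, MeasurableSet (A k)) → (∀ k, Bornology.IsBounded (A k)) →
    (Pairwise fun k l => Disjoint (A k) (A l)) →
    iIndepFun (fun k ω => (Φ ω ∩ A k).encard) P

/-- The distance `r_n` from the base station, located at the origin, to the `n`-th nearest point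
of the configuration `S`: the smallest radius `r` such that the closed disc of radius `r` about the
origin contains at least `n` points of `S`. -/
def nearestDist (S : Set Plane) (n : ℕ) : ℝ :=
  sInf {r : ℝ | 0 ≤ r ∧ (n : ℕ∞) ≤ (S ∩ Metric.closedBall 0 r).encard}

/-- The (unconstrained) numerical parameters of the pushing scheme: path loss exponent `α`,
transmit SNR `ρ`, number `M` of superimposed files, index `t` of the content server with the QoS
target, target rates `R l` of the files `f_l`, and the fractions `β l`, `2 ≤ l ≤ M`, of the
remaining power. -/
structure Params where
  α : ℝ
  ρ : ℝ
  M : ℕ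
  t : ℕ
  R : ℕ → ℝ
  β : ℕ → ℝ

namespace Params

variable (p : Params)

/-- `ε_l = 2 ^ R_l - 1`. -/
def ε (l : ℕ) : ℝ := (2 : ℝ) ^ p.R l - 1

/-- The channel gain `z_n = 1 / r_n ^ α` of the `n`-th nearest content server. -/
def gain (S : Set Plane) (n : ℕ) : ℝ := 1 / nearestDist S n ^ p.α

/-- The power `P_r` that remains after the power of `f_1` has been deducted. -/
def remainingPower (S : Set Plane) : ℝ :=
  max 0 ((p.ρ * p.gain S p.t - p.ε 1) / (p.ρ * (1 + p.ε 1) * p.gain S p.t))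

/-- The squared power allocation coefficient `α_l ^ 2` of the file `f_l`. -/
def powerSq (S : Set Plane) (l : ℕ) : ℝ :=
  if l = 1 then
    min 1 (p.ε 1 * (p.ρ * p.gain S p.t + 1) / (p.ρ * (1 + p.ε 1) * p.gain S p.t))
  else p.β l * p.remainingPower S

/-- The rate with which the `m`-th nearest content server can decode `f_i`, once the files
`f_j`, `j < i`, have been decoded and subtracted. -/
def rate (S : Set Plane) (m i : ℕ) : ℝ :=
  Real.logb 2 (1 + p.ρ * p.powerSq S i * p.gain S m /
    (p.ρ * p.gain S m * (∑ j ∈ Finset.Icc (i + 1) p.M, p.powerSq S j) + 1))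

/-- The `m`-th nearest content server decodes `f_i` by successive interference cancellation:
it decodes all of `f_1, …, f_i`, one after the other. -/
def Decodes (S : Set Plane) (m i : ℕ) : Prop :=
  ∀ j ∈ Finset.Icc 1 i, p.R j ≤ p.rate S m j

/-- The outage probability of the `m`-th nearest content server for decoding `f_i`. -/
def outageProb {Ω : Type*} [MeasurableSpace Ω] (P : Measure Ω) (Φ : Ω → Set Plane)
    (m i : ℕ) : ℝ :=
  P.real {ω | ¬ p.Decodes (Φ ω) m i}

/-- `ξ̄_i = β_i - ε_i ∑_{j > i} β_j`; the sum is empty for `i = M`. -/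
def xiBar (i : ℕ) : ℝ := p.β i - p.ε i * ∑ j ∈ Finset.Icc (i + 1) p.M, p.β j

/-- `φ_i = min {ξ̄_2 / ε_2, …, ξ̄_i / ε_i}`, for `i ≥ 2`. -/
def phi (i : ℕ) : ℝ := sInf ((fun j => p.xiBar j / p.ε j) '' Set.Icc 2 i)

def tau₁ (i : ℕ) : ℝ :=
  (p.ρ * p.phi i / (1 + p.ε 1 + p.ε 1 * p.phi i)) ^ (1 / p.α)

def tau₂ : ℝ := (p.ε 1 / p.ρ) ^ (-(1 / p.α))

def g (i : ℕ) (y : ℝ) : ℝ :=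
  ((1 + p.ε 1) / (p.phi i * (p.ρ - p.ε 1 * y ^ p.α))) ^ (-(1 / p.α))

/-- The joint pdf of the distances `r_m` and `r_t`, at `0 < x < y`. -/
def jointPdf (lam : ℝ) (m : ℕ) (x y : ℝ) : ℝ :=
  4 * y * (lam * Real.pi) ^ p.t * Real.exp (-(lam * Real.pi * y ^ 2)) *
    (x ^ (2 * m - 1) * (y ^ 2 - x ^ 2) ^ (p.t - m - 1) /
      (((p.t - m - 1)! : ℝ) * ((m - 1)! : ℝ)))

/-- The integrand `f_m`, for the file `f_i` and the summation index `q ≤ t - m - 1`. -/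
def fm (lam : ℝ) (m i q : ℕ) (y : ℝ) : ℝ :=
  Real.exp (-(lam * Real.pi * y ^ 2)) * y ^ (2 * (p.t - m - 1) - 2 * q + 1) /
      (2 * (m : ℝ) + 2 * (q : ℝ)) *
    (y ^ (2 * m + 2 * q) - p.g i y ^ (2 * m + 2 * q))

end Params

/-- The node `w_l = cos ((2 l - 1) π / (2 N))`. -/
def chebNode (N l : ℕ) : ℝ := Real.cos ((2 * (l : ℝ) - 1) / (2 * (N : ℝ)) * Real.pi)

/-- The `N`-point Chebyshev-Gauss quadrature of `∫ y in a..b, f y`. -/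
def chebGauss (N : ℕ) (f : ℝ → ℝ) (a b : ℝ) : ℝ :=
  ∑ l ∈ Finset.Icc 1 N, Real.pi * (b - a) / (2 * (N : ℝ)) *
    f ((b - a) / 2 * chebNode N l + (b + a) / 2) * √(1 - chebNode N l ^ 2)

end ContentPush

end

/-! Outage is a deterministic condition on the pair (r_m, r_t), so the proof needs only that
condition and the joint law of the two distances.

Deterministic side. The power of f_1 is chosen so that either no power remains for the other files
or CS_t decodes f_1 with SINR exactly ε_1; hence a server no farther than CS_t decodes f_1 iff its
own distance is at most τ₂. For j ≥ 2 all powers scale with P_r, the rate condition becomes 1 ≤ ρ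
z_m P_r ξ̄_j/ε_j, and the worst j gives φ_i. Solving for distances yields r_t ≤ τ₂ and r_m ≤ g(r_t)
(`decodes_iff`), or a single threshold when m = t (`decodes_self_iff`).

Probabilistic side. Almost surely r_n > x iff the disc of radius x has fewer than n points, which
gives the Poisson sums for one distance. For two distances, the counts in a disc and in the
surrounding annulus are independent; this gives the joint survival function, and differentiating in
y and then in x, with telescoping sums, leads to the stated density (`IsHPPP.map_nearestDist`).

Conclusion. Outage at m < t is the disjoint union of r_t > τ₂ and {r_t ≤ τ₂, r_m > g(r_t)}. In the
second event g(y) < y forces y > τ₁, whence the double integral. The binomial theorem evaluates its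
inner integral. The resulting f_{m,p} are continuous on [τ₁, τ₂], and for continuous functions
Chebyshev–Gauss quadrature is a midpoint rule in the angle (`tendsto_chebGauss`). -/

noncomputable section

namespace ContentPush

/-! ### Decoding conditions as inequalities between distances -/

namespace Params

variable {p : Params} {S : Set Plane}

lemma ε_pos {l : ℕ} (h : 0 < p.R l) : 0 < p.ε l :=
  sub_pos.2 (Real.one_lt_rpow one_lt_two h)

lemma le_logb_one_add_iff {l : ℕ} {x : ℝ} (hx : 0 ≤ x) :
    p.R l ≤ Real.logb 2 (1 + x) ↔ p.ε l ≤ x := by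
  rw [Real.le_logb_iff_rpow_le one_lt_two (by linarith), ε]
  constructor <;> intro h <;> linarith

lemma gain_pos {n : ℕ} (h : 0 < nearestDist S n) : 0 < p.gain S n := by
  unfold gain; positivity

lemma le_mul_gain_iff {n : ℕ} {c : ℝ} (hα : 0 < p.α) (hc : 0 < c) {b : ℝ} (hb : 0 < b)
    (h : 0 < nearestDist S n) :
    c ≤ b * p.gain S n ↔ nearestDist S n ≤ (b / c) ^ p.α⁻¹ := by
  have h1 : 0 < nearestDist S n ^ p.α := by positivity
  rw [Real.le_rpow_inv_iff_of_pos h.le (by positivity) hα, gain, mul_one_div, le_div_iff₀ h1,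
    le_div_iff₀ hc, mul_comm]

lemma gain_le_gain (hα : 0 < p.α) {m n : ℕ} (hm : 0 < nearestDist S m)
    (hmn : nearestDist S m ≤ nearestDist S n) : p.gain S n ≤ p.gain S m := by
  unfold gain
  gcongr

lemma remainingPower_nonneg : 0 ≤ p.remainingPower S := le_max_left _ _

lemma remainingPower_of_le (hρ : 0 < p.ρ) (hε : 0 < p.ε 1) (hz : 0 < p.gain S p.t)
    (h : p.ρ * p.gain S p.t ≤ p.ε 1) : p.remainingPower S = 0 :=
  max_eq_left (div_nonpos_of_nonpos_of_nonneg (by linarith) (by positivity))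

lemma remainingPower_of_ge (hρ : 0 < p.ρ) (hε : 0 < p.ε 1) (hz : 0 < p.gain S p.t)
    (h : p.ε 1 ≤ p.ρ * p.gain S p.t) :
    p.remainingPower S =
      (p.ρ * p.gain S p.t - p.ε 1) / (p.ρ * (1 + p.ε 1) * p.gain S p.t) :=
  max_eq_right (div_nonneg (by linarith) (by positivity))

lemma powerSq_one_of_le (hρ : 0 < p.ρ) (hε : 0 < p.ε 1) (hz : 0 < p.gain S p.t)
    (h : p.ρ * p.gain S p.t ≤ p.ε 1) : p.powerSq S 1 = 1 := by
  rw [powerSq, if_pos rfl]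
  refine min_eq_left ((one_le_div (by positivity)).2 ?_)
  nlinarith

lemma powerSq_one_of_ge (hρ : 0 < p.ρ) (hε : 0 < p.ε 1) (hz : 0 < p.gain S p.t)
    (h : p.ε 1 ≤ p.ρ * p.gain S p.t) :
    p.powerSq S 1 = p.ε 1 * (p.ρ * p.gain S p.t + 1) / (p.ρ * (1 + p.ε 1) * p.gain S p.t) := by
  rw [powerSq, if_pos rfl]
  refine min_eq_right ((div_le_one (by positivity)).2 ?_)
  nlinarith

lemma powerSq_of_two_le {l : ℕ} (hl : 2 ≤ l) :
    p.powerSq S l = p.β l * p.remainingPower S := if_neg (by omega)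

lemma sum_powerSq {l : ℕ} (hl : 1 ≤ l) :
    ∑ j ∈ Finset.Icc (l + 1) p.M, p.powerSq S j =
      (∑ j ∈ Finset.Icc (l + 1) p.M, p.β j) * p.remainingPower S := by
  rw [Finset.sum_mul]
  refine Finset.sum_congr rfl fun j hj => powerSq_of_two_le ?_
  have := (Finset.mem_Icc.1 hj).1
  omega

/-- Downward induction from j = M: ξ̄_j > 0 says that β_j exceeds ε_j times the sum of the later
fractions, which are already known to be positive. -/
lemma β_pos (hR : ∀ l ∈ Finset.Icc 1 p.M, 0 < p.R l)
    (hξ : ∀ j ∈ Finset.Icc 2 p.M, 0 < p.xiBar j) :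
    ∀ j ∈ Finset.Icc 2 p.M, 0 < p.β j := by
  suffices h : ∀ k j, j + k = p.M → 2 ≤ j → 0 < p.β j by
    intro j hj
    rw [Finset.mem_Icc] at hj
    exact h (p.M - j) j (by omega) hj.1
  intro k
  induction k using Nat.strong_induction_on with
  | _ k ih =>
    intro j hjk hj
    have h1 := hξ j (Finset.mem_Icc.2 ⟨hj, by omega⟩)
    have h2 := ε_pos (hR j (Finset.mem_Icc.2 ⟨by omega, by omega⟩))
    have h3 : 0 ≤ ∑ l ∈ Finset.Icc (j + 1) p.M, p.β l := by
      refine Finset.sum_nonneg fun l hl => ?_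
      rw [Finset.mem_Icc] at hl
      exact (ih (p.M - l) (by omega) l (by omega) (by omega)).le
    unfold xiBar at h1
    nlinarith [mul_nonneg h2.le h3]

/-- If ρ z_t ≤ ε_1, all power goes to f_1 and there is no interference. Otherwise the SINR of f_1 at
CS_t equals ε_1, and since z_m ≥ z_t both sides of the equivalence are true. -/
lemma le_rate_one_iff (hα : 0 < p.α) (hρ : 0 < p.ρ) (hε : 0 < p.ε 1)
    (hβ : ∑ j ∈ Finset.Icc 2 p.M, p.β j = 1) {m : ℕ} (hm : 0 < nearestDist S m)
    (hmt : nearestDist S m ≤ nearestDist S p.t) :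
    p.R 1 ≤ p.rate S m 1 ↔ p.ε 1 ≤ p.ρ * p.gain S m := by
  have hzt : 0 < p.gain S p.t := gain_pos (hm.trans_le hmt)
  have hzm : 0 < p.gain S m := gain_pos hm
  have hz : p.gain S p.t ≤ p.gain S m := gain_le_gain hα hm hmt
  rw [rate, sum_powerSq le_rfl]
  norm_num only [hβ, one_mul]
  rcases le_total (p.ρ * p.gain S p.t) (p.ε 1) with h | h
  · rw [powerSq_one_of_le hρ hε hzt h, remainingPower_of_le hρ hε hzt h, mul_zero, zero_add,
      mul_one, div_one, le_logb_one_add_iff (by positivity)]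
  · rw [powerSq_one_of_ge hρ hε hzt h, le_logb_one_add_iff
      (by have := remainingPower_nonneg (p := p) (S := S); positivity),
      remainingPower_of_ge hρ hε hzt h]
    have h0 : 0 ≤ p.ρ * p.gain S p.t - p.ε 1 := by linarith
    refine iff_of_true ?_ (h.trans (by gcongr))
    rw [le_div_iff₀ (by positivity)]
    have e1 : p.ε 1 * (p.ρ * p.gain S m * ((p.ρ * p.gain S p.t - p.ε 1) /
        (p.ρ * (1 + p.ε 1) * p.gain S p.t)) + 1) =
        p.ε 1 * (p.gain S m * (p.ρ * p.gain S p.t - p.ε 1) + (1 + p.ε 1) * p.gain S p.t) /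
          ((1 + p.ε 1) * p.gain S p.t) := by field_simp
    have e2 : p.ρ * (p.ε 1 * (p.ρ * p.gain S p.t + 1) / (p.ρ * (1 + p.ε 1) * p.gain S p.t)) *
        p.gain S m = p.ε 1 * (p.gain S m * (p.ρ * p.gain S p.t + 1)) /
          ((1 + p.ε 1) * p.gain S p.t) := by field_simp
    rw [e1, e2]
    gcongr
    nlinarith

/-- Signal and interference are both proportional to P_r, so clearing the denominator collects the
coefficients into ξ̄_j. -/
lemma le_rate_iff (hρ : 0 < p.ρ) (hR : ∀ l ∈ Finset.Icc 1 p.M, 0 < p.R l)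
    (hξ : ∀ j ∈ Finset.Icc 2 p.M, 0 < p.xiBar j) {m j : ℕ} (hm : 0 < nearestDist S m)
    (hj : j ∈ Finset.Icc 2 p.M) :
    p.R j ≤ p.rate S m j ↔ 1 ≤ p.ρ * p.gain S m * p.remainingPower S * (p.xiBar j / p.ε j) := by
  have hj' := Finset.mem_Icc.1 hj
  have hz : 0 < p.gain S m := gain_pos hm
  have hP := remainingPower_nonneg (p := p) (S := S)
  have hβj := β_pos hR hξ j hj
  have hε : 0 < p.ε j := ε_pos (hR j (Finset.mem_Icc.2 ⟨by omega, hj'.2⟩))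
  have hs : 0 ≤ ∑ l ∈ Finset.Icc (j + 1) p.M, p.β l :=
    Finset.sum_nonneg fun l hl => (β_pos hR hξ l
      (Finset.mem_Icc.2 ⟨by have := (Finset.mem_Icc.1 hl).1; omega, (Finset.mem_Icc.1 hl).2⟩)).le
  rw [rate, powerSq_of_two_le hj'.1, sum_powerSq (by omega), le_logb_one_add_iff (by positivity),
    le_div_iff₀ (by positivity), ← mul_div_assoc, one_le_div hε, xiBar]
  constructor <;> intro h <;> linarith

lemma ε_pos_of_mem_Icc (hR : ∀ l ∈ Finset.Icc 1 p.M, 0 < p.R l) {i j : ℕ} (hi : i ≤ p.M)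
    (hj : j ∈ Set.Icc 2 i) : 0 < p.ε j :=
  ε_pos (hR j (Finset.mem_Icc.2 ⟨by have := hj.1; omega, hj.2.trans hi⟩))

lemma phi_le {i j : ℕ} (hj : j ∈ Set.Icc 2 i) : p.phi i ≤ p.xiBar j / p.ε j :=
  csInf_le ((Set.finite_Icc 2 i).image _).bddBelow ⟨j, hj, rfl⟩

lemma exists_phi_eq {i : ℕ} (hi : 2 ≤ i) : ∃ j ∈ Set.Icc 2 i, p.xiBar j / p.ε j = p.phi i :=
  ((Set.nonempty_Icc.2 hi).image _).csInf_mem ((Set.finite_Icc 2 i).image _)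

lemma phi_pos (hR : ∀ l ∈ Finset.Icc 1 p.M, 0 < p.R l)
    (hξ : ∀ j ∈ Finset.Icc 2 p.M, 0 < p.xiBar j) {i : ℕ} (hi : 2 ≤ i) (hiM : i ≤ p.M) :
    0 < p.phi i := by
  obtain ⟨j, hj, h⟩ := p.exists_phi_eq hi
  rw [← h]
  exact div_pos (hξ j (Finset.mem_Icc.2 ⟨hj.1, hj.2.trans hiM⟩)) (ε_pos_of_mem_Icc hR hiM hj)

lemma decodes_one_iff (hα : 0 < p.α) (hρ : 0 < p.ρ) (hε : 0 < p.ε 1)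
    (hβ : ∑ j ∈ Finset.Icc 2 p.M, p.β j = 1) {m : ℕ} (hm : 0 < nearestDist S m)
    (hmt : nearestDist S m ≤ nearestDist S p.t) :
    p.Decodes S m 1 ↔ nearestDist S m ≤ (p.ρ / p.ε 1) ^ p.α⁻¹ := by
  rw [← le_mul_gain_iff hα hε hρ hm, ← le_rate_one_iff hα hρ hε hβ hm hmt, Decodes]
  simp

/-- For `i ≥ 2`, decoding the files `f_2, …, f_i` already entails that `f_1` is decoded. -/
lemma decodes_iff_gain (hα : 0 < p.α) (hρ : 0 < p.ρ) (hR : ∀ l ∈ Finset.Icc 1 p.M, 0 < p.R l)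
    (hβ : ∑ j ∈ Finset.Icc 2 p.M, p.β j = 1)
    (hξ : ∀ j ∈ Finset.Icc 2 p.M, 0 < p.xiBar j) {m i : ℕ} (hi : 2 ≤ i) (hiM : i ≤ p.M)
    (hm : 0 < nearestDist S m) (hmt : nearestDist S m ≤ nearestDist S p.t) :
    p.Decodes S m i ↔ p.ε 1 < p.ρ * p.gain S p.t ∧
      (1 + p.ε 1) * p.gain S p.t ≤
        p.phi i * p.gain S m * (p.ρ * p.gain S p.t - p.ε 1) := by
  have hzt : 0 < p.gain S p.t := gain_pos (hm.trans_le hmt)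
  have hzm : 0 < p.gain S m := gain_pos hm
  have hz : p.gain S p.t ≤ p.gain S m := gain_le_gain hα hm hmt
  have hφ := phi_pos hR hξ hi hiM
  have hε : 0 < p.ε 1 := ε_pos (hR 1 (Finset.mem_Icc.2 ⟨le_rfl, by omega⟩))
  have hP := remainingPower_nonneg (p := p) (S := S)
  have key : p.Decodes S m i ↔ p.ε 1 ≤ p.ρ * p.gain S m ∧
      1 ≤ p.ρ * p.gain S m * p.remainingPower S * p.phi i := by
    rw [← le_rate_one_iff hα hρ hε hβ hm hmt]
    constructor
    · intro h
      refine ⟨h 1 (Finset.mem_Icc.2 ⟨le_rfl, by omega⟩), ?_⟩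
      obtain ⟨j, hj, e⟩ := p.exists_phi_eq hi
      rw [← e, ← le_rate_iff hρ hR hξ hm (Finset.mem_Icc.2 ⟨hj.1, hj.2.trans hiM⟩)]
      exact h j (Finset.mem_Icc.2 ⟨by have := hj.1; omega, hj.2⟩)
    · rintro ⟨h1, h2⟩ j hj
      rw [Finset.mem_Icc] at hj
      rcases hj.1.eq_or_lt with rfl | hj1
      · exact h1
      · rw [le_rate_iff hρ hR hξ hm (Finset.mem_Icc.2 ⟨hj1, hj.2.trans hiM⟩)]
        refine h2.trans ?_
        gcongr
        exact phi_le ⟨hj1, hj.2⟩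
  rw [key]
  rcases le_or_gt (p.ρ * p.gain S p.t) (p.ε 1) with h | h
  · rw [remainingPower_of_le hρ hε hzt h]
    simp [h.not_gt]
  · have e : p.ρ * p.gain S m * ((p.ρ * p.gain S p.t - p.ε 1) /
        (p.ρ * (1 + p.ε 1) * p.gain S p.t)) * p.phi i =
        p.phi i * p.gain S m * (p.ρ * p.gain S p.t - p.ε 1) / ((1 + p.ε 1) * p.gain S p.t) := by
      field_simp
    rw [remainingPower_of_ge hρ hε hzt h.le, e, one_le_div (by positivity)]
    simp only [h, true_and, and_iff_right_iff_imp]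
    -- The condition for f_1 is free here: ε_1 < ρ z_t ≤ ρ z_m.
    exact fun _ => h.le.trans (by gcongr)

/-- For m = t the gain cancels and a linear inequality z_t ≥ θ_i remains, which already forces ρ z_t
> ε_1. -/
lemma decodes_self_iff (hα : 0 < p.α) (hρ : 0 < p.ρ) (hR : ∀ l ∈ Finset.Icc 1 p.M, 0 < p.R l)
    (hβ : ∑ j ∈ Finset.Icc 2 p.M, p.β j = 1)
    (hξ : ∀ j ∈ Finset.Icc 2 p.M, 0 < p.xiBar j) {i : ℕ} (hi : 2 ≤ i) (hiM : i ≤ p.M)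
    (ht : 0 < nearestDist S p.t) :
    p.Decodes S p.t i ↔ nearestDist S p.t ≤
      (1 / (p.ε 1 / p.ρ + (1 + p.ε 1) / (p.ρ * p.phi i))) ^ p.α⁻¹ := by
  have hzt : 0 < p.gain S p.t := gain_pos ht
  have hφ := phi_pos hR hξ hi hiM
  have hε : 0 < p.ε 1 := ε_pos (hR 1 (Finset.mem_Icc.2 ⟨le_rfl, by omega⟩))
  rw [decodes_iff_gain hα hρ hR hβ hξ hi hiM ht le_rfl,
    ← le_mul_gain_iff hα (by positivity) one_pos ht, one_mul]
  have e : p.ε 1 / p.ρ + (1 + p.ε 1) / (p.ρ * p.phi i) =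
      (p.ε 1 * p.phi i + (1 + p.ε 1)) / (p.ρ * p.phi i) := by field_simp
  rw [e, div_le_iff₀ (by positivity)]
  have e2 : (1 + p.ε 1) * p.gain S p.t ≤ p.phi i * p.gain S p.t * (p.ρ * p.gain S p.t - p.ε 1) ↔
      1 + p.ε 1 ≤ p.phi i * (p.ρ * p.gain S p.t - p.ε 1) := by
    rw [show p.phi i * p.gain S p.t * (p.ρ * p.gain S p.t - p.ε 1) =
      (p.phi i * (p.ρ * p.gain S p.t - p.ε 1)) * p.gain S p.t by ring]
    exact mul_le_mul_iff_left₀ hzt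
  rw [e2]
  constructor
  · rintro ⟨-, h⟩
    linarith
  · intro h
    refine ⟨?_, by linarith⟩
    by_contra! h'
    nlinarith [mul_nonneg hφ.le (sub_nonneg.2 h')]

lemma tau₂_eq (hρ : 0 < p.ρ) (hε : 0 < p.ε 1) : p.tau₂ = (p.ρ / p.ε 1) ^ p.α⁻¹ := by
  rw [tau₂, Real.rpow_neg (by positivity), ← Real.inv_rpow (by positivity), inv_div, one_div]

lemma le_tau₂_iff (hα : 0 < p.α) (hρ : 0 < p.ρ) (hε : 0 < p.ε 1) {y : ℝ} (hy : 0 ≤ y) :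
    y ≤ p.tau₂ ↔ 0 ≤ p.ρ - p.ε 1 * y ^ p.α := by
  rw [tau₂_eq hρ hε, Real.le_rpow_inv_iff_of_pos hy (by positivity) hα, le_div_iff₀ hε,
    sub_nonneg, mul_comm]

/-- Equality is allowed in `h`: at y = τ₂ division by zero makes the left side 0, in agreement with
the convention g(τ₂) = 0. This form of g is visibly continuous up to that endpoint. -/
lemma g_eq {i : ℕ} {y : ℝ} (hε : 0 < p.ε 1) (hφ : 0 < p.phi i)
    (h : 0 ≤ p.ρ - p.ε 1 * y ^ p.α) :
    p.g i y = (p.phi i * (p.ρ - p.ε 1 * y ^ p.α) / (1 + p.ε 1)) ^ p.α⁻¹ := by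
  rw [g, Real.rpow_neg (by positivity), ← Real.inv_rpow (by positivity), inv_div, one_div]

lemma g_nonneg {i : ℕ} {y : ℝ} (hε : 0 < p.ε 1) (hφ : 0 < p.phi i)
    (h : 0 ≤ p.ρ - p.ε 1 * y ^ p.α) : 0 ≤ p.g i y := by
  rw [g_eq hε hφ h]
  positivity

lemma decodes_iff (hα : 0 < p.α) (hρ : 0 < p.ρ) (hR : ∀ l ∈ Finset.Icc 1 p.M, 0 < p.R l)
    (hβ : ∑ j ∈ Finset.Icc 2 p.M, p.β j = 1)
    (hξ : ∀ j ∈ Finset.Icc 2 p.M, 0 < p.xiBar j) {m i : ℕ} (hi : 2 ≤ i) (hiM : i ≤ p.M)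
    (hm : 0 < nearestDist S m) (hmt : nearestDist S m ≤ nearestDist S p.t) :
    p.Decodes S m i ↔
      nearestDist S p.t ≤ p.tau₂ ∧ nearestDist S m ≤ p.g i (nearestDist S p.t) := by
  have ht := hm.trans_le hmt
  have hφ := phi_pos hR hξ hi hiM
  have hε : 0 < p.ε 1 := ε_pos (hR 1 (Finset.mem_Icc.2 ⟨le_rfl, by omega⟩))
  have hmα : 0 < nearestDist S m ^ p.α := by positivity
  have htα : 0 < nearestDist S p.t ^ p.α := by positivity
  rw [decodes_iff_gain hα hρ hR hβ hξ hi hiM hm hmt, le_tau₂_iff hα hρ hε ht.le]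
  set a := nearestDist S m ^ p.α
  set b := nearestDist S p.t ^ p.α
  have e1 : p.ε 1 < p.ρ * p.gain S p.t ↔ 0 < p.ρ - p.ε 1 * b := by
    rw [gain, mul_one_div, lt_div_iff₀ htα, sub_pos]
  have e2 : (1 + p.ε 1) * p.gain S p.t ≤ p.phi i * p.gain S m * (p.ρ * p.gain S p.t - p.ε 1) ↔
      a ≤ p.phi i * (p.ρ - p.ε 1 * b) / (1 + p.ε 1) := by
    have e3 : p.phi i * p.gain S m * (p.ρ * p.gain S p.t - p.ε 1) =
        (p.phi i * (p.ρ - p.ε 1 * b) / a) / b := by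
      simp only [gain, a, b]
      field_simp
    have e4 : (1 + p.ε 1) * p.gain S p.t = (1 + p.ε 1) / b := by
      simp only [gain, b]
      field_simp
    rw [e3, e4, div_le_div_iff_of_pos_right htα, le_div_iff₀ hmα, le_div_iff₀ (by positivity),
      mul_comm]
  rw [e1, e2]
  constructor
  · rintro ⟨h1, h2⟩
    refine ⟨h1.le, ?_⟩
    rw [g_eq hε hφ h1.le]
    exact (Real.le_rpow_inv_iff_of_pos hm.le (by positivity) hα).2 h2
  · rintro ⟨h1, h2⟩
    rw [g_eq hε hφ h1] at h2
    have h3 := (Real.le_rpow_inv_iff_of_pos hm.le (by positivity) hα).1 h2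
    -- At r_t = τ₂ the bound would read r_m ^ α ≤ 0, so the strict inequality is recovered from r_m
    -- > 0.
    refine ⟨h1.lt_of_ne fun h => ?_, h3⟩
    rw [← h, mul_zero, zero_div] at h3
    exact hmα.not_ge h3

lemma tau₁_nonneg (hρ : 0 < p.ρ) (hε : 0 < p.ε 1) {i : ℕ} (hφ : 0 < p.phi i) :
    0 ≤ p.tau₁ i := by
  unfold tau₁
  positivity

lemma tau₁_le_tau₂ (hα : 0 < p.α) (hρ : 0 < p.ρ) (hε : 0 < p.ε 1) {i : ℕ} (hφ : 0 < p.phi i) :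
    p.tau₁ i ≤ p.tau₂ := by
  rw [tau₁, tau₂_eq hρ hε, one_div]
  gcongr ?_ ^ _
  rw [div_le_div_iff₀ (by positivity) hε]
  nlinarith

/-- After raising to the power α, both inequalities are the same linear one in y ^ α. This is what
makes τ₁ the lower limit of the outer integral. -/
lemma g_lt_self_iff (hα : 0 < p.α) (hρ : 0 < p.ρ) (hε : 0 < p.ε 1) {i : ℕ} (hφ : 0 < p.phi i)
    {y : ℝ} (hy : 0 ≤ y) (hy' : y ≤ p.tau₂) : p.g i y < y ↔ p.tau₁ i < y := by
  have h := (le_tau₂_iff hα hρ hε hy).1 hy'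
  rw [g_eq hε hφ h, tau₁, one_div, Real.rpow_inv_lt_iff_of_pos (by positivity) hy hα,
    Real.rpow_inv_lt_iff_of_pos (by positivity) hy hα, div_lt_iff₀ (by positivity),
    div_lt_iff₀ (by positivity)]
  constructor <;> intro h <;> linarith

lemma continuousOn_g (hα : 0 < p.α) (hρ : 0 < p.ρ) (hε : 0 < p.ε 1) {i : ℕ} (hφ : 0 < p.phi i) :
    ContinuousOn (p.g i) (Set.Icc 0 p.tau₂) := by
  have h : ContinuousOn
      (fun y : ℝ => (p.phi i * (p.ρ - p.ε 1 * y ^ p.α) / (1 + p.ε 1)) ^ p.α⁻¹)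
      (Set.Icc 0 p.tau₂) := by
    have h1 : Continuous fun y : ℝ => p.phi i * (p.ρ - p.ε 1 * y ^ p.α) / (1 + p.ε 1) := by
      have := Real.continuous_rpow_const hα.le
      fun_prop
    exact ((Real.continuous_rpow_const (by positivity)).comp h1).continuousOn
  exact h.congr fun y hy => g_eq hε hφ ((le_tau₂_iff hα hρ hε hy.1).1 hy.2)

end Params

/-! ### Poisson tails and nearest distances in locally finite configurations -/

/-- The probability that a Poisson variable of mean `s` is less than `n`. -/
def poissonLower (n : ℕ) (s : ℝ) : ℝ :=
  ∑ k ∈ Finset.range n, Real.exp (-s) * s ^ k / (k ! : ℝ)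

lemma tendsto_poissonLower (n : ℕ) : Tendsto (poissonLower n) atTop (𝓝 0) := by
  have h : ∀ k ∈ Finset.range n,
      Tendsto (fun s : ℝ => Real.exp (-s) * s ^ k / (k ! : ℝ)) atTop (𝓝 0) := by
    intro k _
    have := (Real.tendsto_pow_mul_exp_neg_atTop_nhds_zero k).div_const (k ! : ℝ)
    rw [zero_div] at this
    exact this.congr fun s => by rw [mul_comm]
  have := tendsto_finsetSum _ h
  rw [Finset.sum_const_zero] at this
  exact this

lemma nearestDist_nonneg (S : Set Plane) (n : ℕ) : 0 ≤ nearestDist S n :=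
  Real.sInf_nonneg fun _ h => h.1

/-- In a locally finite configuration, discs have the same points as slightly larger ones. -/
lemma exists_gt_inter_closedBall_eq {S : Set Plane}
    (hfin : ∀ k : ℕ, (S ∩ Metric.closedBall 0 (k : ℝ)).Finite) (x : ℝ) :
    ∃ y > x, S ∩ Metric.closedBall 0 y = S ∩ Metric.closedBall 0 x := by
  obtain ⟨k, hk⟩ := exists_nat_gt x
  set T := ((fun s : Plane => ‖s‖) '' (S ∩ Metric.closedBall 0 (k : ℝ))) ∩ Set.Ioi x
  have hTfin : T.Finite := ((hfin k).image _).subset Set.inter_subset_left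
  have hopen : ∀ᶠ y : ℝ in 𝓝[>] x, y < k ∧ ∀ s ∈ T, y < s := by
    refine (Filter.Eventually.and ?_ ((eventually_all_finite hTfin).2 fun s hs => ?_))
    · exact nhdsWithin_le_nhds (Iio_mem_nhds hk)
    · exact nhdsWithin_le_nhds (Iio_mem_nhds hs.2)
  obtain ⟨y, ⟨hyk, hy⟩, hxy⟩ := (hopen.and self_mem_nhdsWithin).exists
  refine ⟨y, hxy, Set.Subset.antisymm (fun s hs => ⟨hs.1, ?_⟩)
    (Set.inter_subset_inter_right _ (Metric.closedBall_subset_closedBall (le_of_lt hxy)))⟩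
  by_contra hsx
  have hsy := hs.2
  rw [mem_closedBall_zero_iff] at hsx hsy
  exact (hy ‖s‖ ⟨⟨s, ⟨hs.1, mem_closedBall_zero_iff.2 (hsy.trans hyk.le)⟩, rfl⟩,
    not_le.1 hsx⟩).not_ge hsy

/-- Local finiteness makes the infimum attained: a slightly larger disc contains no new points. The
hypothesis `hn` keeps the set of radii nonempty, since `sInf ∅ = 0` would falsify the forward
direction. -/
lemma nearestDist_le_iff_of_locallyFinite {S : Set Plane}
    (hfin : ∀ k : ℕ, (S ∩ Metric.closedBall 0 (k : ℝ)).Finite)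
    {n : ℕ} (hn : ∃ k : ℕ, (n : ℕ∞) ≤ (S ∩ Metric.closedBall 0 (k : ℝ)).encard)
    {x : ℝ} (hx : 0 ≤ x) :
    nearestDist S n ≤ x ↔ (n : ℕ∞) ≤ (S ∩ Metric.closedBall 0 x).encard := by
  constructor
  · intro h
    obtain ⟨y, hxy, hy⟩ := exists_gt_inter_closedBall_eq hfin x
    obtain ⟨k, hk⟩ := hn
    have hne : {r : ℝ | 0 ≤ r ∧ (n : ℕ∞) ≤ (S ∩ Metric.closedBall 0 r).encard}.Nonempty :=
      ⟨(k : ℝ), Nat.cast_nonneg k, hk⟩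
    obtain ⟨r, hr, hry⟩ := exists_lt_of_csInf_lt hne (h.trans_lt hxy)
    rw [← hy]
    exact hr.2.trans (Set.encard_le_encard
      (Set.inter_subset_inter_right _ (Metric.closedBall_subset_closedBall hry.le)))
  · intro h
    have hb : BddBelow {r : ℝ | 0 ≤ r ∧ (n : ℕ∞) ≤ (S ∩ Metric.closedBall 0 r).encard} :=
      ⟨0, fun _ h => h.1⟩
    exact csInf_le hb ⟨hx, h⟩

lemma real_volume_closedBall {x : ℝ} (hx : 0 ≤ x) :
    (volume : Measure Plane).real (Metric.closedBall 0 x) = Real.pi * x ^ 2 := by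
  rw [Measure.real, EuclideanSpace.volume_closedBall_fin_two]
  simp [ENNReal.toReal_ofReal hx, ENNReal.toReal_mul, mul_comm, Real.pi_nonneg]

lemma real_volume_annulus {x y : ℝ} (hx : 0 ≤ x) (hxy : x ≤ y) :
    (volume : Measure Plane).real (Metric.closedBall 0 y \ Metric.closedBall 0 x) =
      Real.pi * (y ^ 2 - x ^ 2) := by
  rw [measureReal_sdiff (Metric.closedBall_subset_closedBall hxy)
    Metric.isClosed_closedBall.measurableSet
    (measure_closedBall_lt_top.ne), real_volume_closedBall hx,
    real_volume_closedBall (hx.trans hxy), mul_sub]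

/-! ### Distances to the points of a Poisson process -/

namespace IsHPPP

variable {Ω : Type*} [MeasurableSpace Ω] {P : Measure Ω} {Φ : Ω → Set Plane} {lam : ℝ}

lemma measurableSet_count (h : IsHPPP P Φ lam) {A : Set Plane} (hA : MeasurableSet A)
    (T : Set ℕ∞) : MeasurableSet {ω | (Φ ω ∩ A).encard ∈ T} :=
  h.measurable_count A hA (Set.to_countable T).measurableSet

lemma measure_count_mem (h : IsHPPP P Φ lam) {A : Set Plane} (hA : MeasurableSet A)
    (hb : Bornology.IsBounded A) (T : Set ℕ∞) :
    P {ω | (Φ ω ∩ A).encard ∈ T} =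
      poissonMeasure (Real.toNNReal (lam * (volume : Measure Plane).real A))
        ((fun k : ℕ => (k : ℕ∞)) ⁻¹' T) := by
  have := DFunLike.congr_fun (h.law_count A hA hb) T
  rwa [Measure.map_apply (h.measurable_count A hA) (Set.to_countable T).measurableSet,
    Measure.map_apply (measurable_of_countable _) (Set.to_countable T).measurableSet] at this

lemma real_count_eq (h : IsHPPP P Φ lam) (hlam : 0 ≤ lam) {A : Set Plane} (hA : MeasurableSet A)
    (hb : Bornology.IsBounded A) (k : ℕ) :
    P.real {ω | (Φ ω ∩ A).encard = k} =
      Real.exp (-(lam * (volume : Measure Plane).real A)) *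
        (lam * (volume : Measure Plane).real A) ^ k / (k ! : ℝ) := by
  have h1 := h.measure_count_mem hA hb {(k : ℕ∞)}
  have h2 : (fun k : ℕ => (k : ℕ∞)) ⁻¹' {(k : ℕ∞)} = {k} := by ext; simp
  rw [h2] at h1
  have h3 := poissonMeasure_real_singleton
    (Real.toNNReal (lam * (volume : Measure Plane).real A)) k
  rw [Measure.real, ← h1, Real.coe_toNNReal _ (by positivity)] at h3
  exact h3

lemma real_count_lt [IsFiniteMeasure P] (h : IsHPPP P Φ lam) (hlam : 0 ≤ lam) {A : Set Plane}
    (hA : MeasurableSet A) (hb : Bornology.IsBounded A) (n : ℕ) :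
    P.real {ω | (Φ ω ∩ A).encard < n} =
      poissonLower n (lam * (volume : Measure Plane).real A) := by
  have e : {ω | (Φ ω ∩ A).encard < n} =
      ⋃ k ∈ Finset.range n, {ω | (Φ ω ∩ A).encard = (k : ℕ∞)} := by
    ext ω
    simp only [Set.mem_ofPred_eq, Set.mem_iUnion, Finset.mem_range, exists_prop]
    constructor
    · intro hω
      obtain ⟨k, hk⟩ := ENat.ne_top_iff_exists.1 hω.ne_top
      exact ⟨k, by rw [← hk] at hω; exact_mod_cast hω, hk.symm⟩
    · rintro ⟨k, hk, e⟩
      rw [e]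
      exact_mod_cast hk
  rw [e, measureReal_biUnion_finset, poissonLower]
  · exact Finset.sum_congr rfl fun k _ => h.real_count_eq hlam hA hb k
  · intro k _ l _ hkl
    refine Set.disjoint_left.2 fun ω h1 h2 => hkl ?_
    have : (k : ℕ∞) = l := h1.symm.trans h2
    exact_mod_cast this
  · exact fun k _ => h.measurableSet_count hA {(k : ℕ∞)}

lemma ae_finite (h : IsHPPP P Φ lam) :
    ∀ᵐ ω ∂P, ∀ k : ℕ, (Φ ω ∩ Metric.closedBall 0 (k : ℝ)).Finite := by
  refine ae_all_iff.2 fun k => ?_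
  have h1 := h.measure_count_mem (A := Metric.closedBall 0 (k : ℝ))
    Metric.isClosed_closedBall.measurableSet Metric.isBounded_closedBall {⊤}
  have h2 : (fun k : ℕ => (k : ℕ∞)) ⁻¹' {⊤} = ∅ := by ext; simp
  rw [h2, measure_empty] at h1
  rw [ae_iff]
  refine measure_mono_null (fun ω hω => ?_) h1
  exact Set.encard_eq_top_iff.2 hω

/-- The exceptional event lies in {fewer than n points in the disc of radius k} for every k, and the
Poisson lower tail vanishes as the mean λπk² grows. -/
lemma ae_exists_le_count [IsFiniteMeasure P] (h : IsHPPP P Φ lam) (hlam : 0 < lam) :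
    ∀ᵐ ω ∂P, ∀ n : ℕ, ∃ k : ℕ, (n : ℕ∞) ≤ (Φ ω ∩ Metric.closedBall 0 (k : ℝ)).encard := by
  refine ae_all_iff.2 fun n => ?_
  rw [ae_iff]
  have hle : ∀ k : ℕ,
      P.real {ω | ¬ ∃ k : ℕ, (n : ℕ∞) ≤ (Φ ω ∩ Metric.closedBall 0 (k : ℝ)).encard} ≤
        poissonLower n (lam * (Real.pi * (k : ℝ) ^ 2)) := by
    intro k
    rw [← real_volume_closedBall (Nat.cast_nonneg k), ← h.real_count_lt hlam.le
      Metric.isClosed_closedBall.measurableSet Metric.isBounded_closedBall n]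
    refine measureReal_mono fun ω hω => ?_
    simp only [not_exists, not_le, Set.mem_ofPred_eq] at hω
    exact hω k
  have ht : Tendsto (fun k : ℕ => poissonLower n (lam * (Real.pi * (k : ℝ) ^ 2))) atTop (𝓝 0) := by
    refine (tendsto_poissonLower n).comp ?_
    refine Tendsto.const_mul_atTop hlam (Tendsto.const_mul_atTop Real.pi_pos ?_)
    exact (tendsto_pow_atTop two_ne_zero).comp tendsto_natCast_atTop_atTop
  have h0 := le_antisymm (ge_of_tendsto' ht hle) measureReal_nonneg
  exact (measureReal_eq_zero_iff).1 h0

/-- Almost surely, the `n`-th nearest point is within distance `x` if and only if the disc of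
radius `x` contains at least `n` points. -/
lemma ae_nearestDist_le_iff [IsFiniteMeasure P] (h : IsHPPP P Φ lam) (hlam : 0 < lam) :
    ∀ᵐ ω ∂P, ∀ (n : ℕ) (x : ℝ), 0 ≤ x →
      (nearestDist (Φ ω) n ≤ x ↔ (n : ℕ∞) ≤ (Φ ω ∩ Metric.closedBall 0 x).encard) := by
  filter_upwards [h.ae_finite, h.ae_exists_le_count hlam] with ω h1 h2 n x hx
  exact nearestDist_le_iff_of_locallyFinite h1 (h2 n) hx

lemma ae_lt_nearestDist_iff [IsFiniteMeasure P] (h : IsHPPP P Φ lam) (hlam : 0 < lam)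
    {x : ℝ} (hx : 0 ≤ x) : ∀ᵐ ω ∂P, ∀ n : ℕ,
      (x < nearestDist (Φ ω) n ↔ (Φ ω ∩ Metric.closedBall 0 x).encard < n) := by
  filter_upwards [h.ae_nearestDist_le_iff hlam] with ω hω n
  rw [← not_le, hω n x hx, not_le]

lemma ae_nearestDist_mono [IsFiniteMeasure P] (h : IsHPPP P Φ lam) (hlam : 0 < lam) :
    ∀ᵐ ω ∂P, Monotone (nearestDist (Φ ω)) := by
  filter_upwards [h.ae_nearestDist_le_iff hlam] with ω hω m n hmn
  rw [hω m _ (nearestDist_nonneg _ _)]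
  refine le_trans (by exact_mod_cast hmn) ((hω n _ (nearestDist_nonneg _ _)).1 le_rfl)

lemma real_lt_nearestDist [IsFiniteMeasure P] (h : IsHPPP P Φ lam) (hlam : 0 < lam) {x : ℝ}
    (hx : 0 ≤ x) (n : ℕ) :
    P.real {ω | x < nearestDist (Φ ω) n} = poissonLower n (lam * Real.pi * x ^ 2) := by
  rw [mul_assoc, ← real_volume_closedBall hx, ← h.real_count_lt hlam.le
    Metric.isClosed_closedBall.measurableSet Metric.isBounded_closedBall n]
  refine measureReal_congr ?_
  filter_upwards [h.ae_lt_nearestDist_iff hlam hx] with ω hω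
  exact propext (hω n)

lemma ae_nearestDist_pos [IsProbabilityMeasure P] (h : IsHPPP P Φ lam) (hlam : 0 < lam) :
    ∀ᵐ ω ∂P, ∀ n : ℕ, 1 ≤ n → 0 < nearestDist (Φ ω) n := by
  have h1 := h.real_count_eq hlam.le (A := Metric.closedBall 0 0)
    Metric.isClosed_closedBall.measurableSet Metric.isBounded_closedBall 0
  rw [real_volume_closedBall le_rfl] at h1
  have h2 : ∀ᵐ ω ∂P, (Φ ω ∩ Metric.closedBall 0 0).encard = (0 : ℕ) := by
    have h3 : P {ω | (Φ ω ∩ Metric.closedBall 0 0).encard = (0 : ℕ)} = 1 := by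
      rw [← ofReal_measureReal, h1]
      simp
    exact (prob_compl_eq_zero_iff (h.measurableSet_count
      Metric.isClosed_closedBall.measurableSet {((0 : ℕ) : ℕ∞)})).2 h3
  filter_upwards [h2, h.ae_lt_nearestDist_iff hlam le_rfl] with ω h2 h3 n hn
  rw [h3, h2]
  exact_mod_cast hn

/-- Sublevel sets are identified with counting events only up to null sets, hence the detour through
null measurability. -/
lemma aemeasurable_nearestDist [IsFiniteMeasure P] (h : IsHPPP P Φ lam) (hlam : 0 < lam) (n : ℕ) :
    AEMeasurable (fun ω => nearestDist (Φ ω) n) P := by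
  refine NullMeasurable.aemeasurable
    (measurable_of_Iic (δ := NullMeasurableSpace Ω P) (f := fun ω => nearestDist (Φ ω) n) fun x => ?_)
  change NullMeasurableSet {ω | nearestDist (Φ ω) n ≤ x} P
  rcases lt_or_ge x 0 with hx | hx
  · convert! nullMeasurableSet_empty using 1
    exact Set.eq_empty_of_forall_notMem fun ω hω => (hω.trans_lt hx).not_ge (nearestDist_nonneg _ _)
  · have hA := h.measurableSet_count (A := Metric.closedBall 0 x)
      Metric.isClosed_closedBall.measurableSet (Set.Ici (n : ℕ∞))
    refine hA.nullMeasurableSet.congr ?_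
    filter_upwards [h.ae_nearestDist_le_iff hlam] with ω hω
    exact propext (hω n x hx).symm

/-- The joint law of two of the distances on quadrants. -/
lemma real_lt_nearestDist_and_lt [IsFiniteMeasure P] (h : IsHPPP P Φ lam) (hlam : 0 < lam)
    {x y : ℝ} (hx : 0 ≤ x) (hxy : x ≤ y) {m t : ℕ} (hmt : m ≤ t) :
    P.real {ω | x < nearestDist (Φ ω) m ∧ y < nearestDist (Φ ω) t} =
      ∑ j ∈ Finset.range m, Real.exp (-(lam * Real.pi * x ^ 2)) * (lam * Real.pi * x ^ 2) ^ j /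
        (j ! : ℝ) * poissonLower (t - j) (lam * Real.pi * (y ^ 2 - x ^ 2)) := by
  set A : Set Plane := Metric.closedBall 0 x
  set B : Set Plane := Metric.closedBall 0 y \ Metric.closedBall 0 x
  have hA : MeasurableSet A := Metric.isClosed_closedBall.measurableSet
  have hB : MeasurableSet B := Metric.isClosed_closedBall.measurableSet.diff hA
  have hAb : Bornology.IsBounded A := Metric.isBounded_closedBall
  have hBb : Bornology.IsBounded B := Metric.isBounded_closedBall.subset Set.sdiff_subset
  have hAB : Disjoint A B := Set.disjoint_sdiff_right
  have hunion : Metric.closedBall (0 : Plane) y = A ∪ B :=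
    (Set.union_sdiff_cancel (Metric.closedBall_subset_closedBall hxy)).symm
  have hadd : ∀ ω, (Φ ω ∩ Metric.closedBall 0 y).encard =
      (Φ ω ∩ A).encard + (Φ ω ∩ B).encard := by
    intro ω
    rw [hunion, Set.inter_union_distrib_left, Set.encard_union_eq]
    exact hAB.mono Set.inter_subset_right Set.inter_subset_right
  have hind : IndepFun (fun ω => (Φ ω ∩ A).encard) (fun ω => (Φ ω ∩ B).encard) P := by
    have := h.indep_count 2 ![A, B] (by simp [Fin.forall_fin_two, hA, hB])
      (by simp [Fin.forall_fin_two, hAb, hBb]) (by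
        intro k l hkl
        fin_cases k <;> fin_cases l <;> simp_all [disjoint_comm])
    exact this.indepFun (i := 0) (j := 1) (by decide)
  -- Split by the number j < m of points in the inner disc; the annulus then has fewer than t - j
  -- points. The subtraction is not truncated because j < m ≤ t.
  have e : {ω | x < nearestDist (Φ ω) m ∧ y < nearestDist (Φ ω) t} =ᵐ[P]
      ⋃ j ∈ Finset.range m, {ω | (Φ ω ∩ A).encard = (j : ℕ∞)} ∩
        {ω | (Φ ω ∩ B).encard < ((t - j : ℕ) : ℕ∞)} := by
    filter_upwards [h.ae_lt_nearestDist_iff hlam hx, h.ae_lt_nearestDist_iff hlam (hx.trans hxy)]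
      with ω h1 h2
    refine propext ?_
    change (x < nearestDist (Φ ω) m ∧ y < nearestDist (Φ ω) t) ↔
      ω ∈ ⋃ j ∈ Finset.range m, {ω | (Φ ω ∩ A).encard = (j : ℕ∞)} ∩
        {ω | (Φ ω ∩ B).encard < ((t - j : ℕ) : ℕ∞)}
    rw [h1, h2, hadd]
    simp only [Set.mem_iUnion, Finset.mem_range, exists_prop, Set.mem_inter_iff, Set.mem_ofPred_eq]
    constructor
    · rintro ⟨h3, h4⟩
      obtain ⟨a, ha⟩ := ENat.ne_top_iff_exists.1 h3.ne_top
      obtain ⟨b, hb⟩ := ENat.ne_top_iff_exists.1 (ne_top_of_le_ne_top h4.ne_top le_add_self)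
      change (Φ ω ∩ A).encard < _ at h3
      rw [← ha] at h3 ⊢
      rw [← ha, ← hb] at h4
      rw [← hb]
      norm_cast at h3 h4 ⊢
      exact ⟨a, h3, rfl, by omega⟩
    · rintro ⟨j, hj, h3, h4⟩
      change (Φ ω ∩ A).encard < _ ∧ _
      rw [h3]
      obtain ⟨b, hb⟩ := ENat.ne_top_iff_exists.1 h4.ne_top
      rw [← hb] at h4 ⊢
      norm_cast at h4 ⊢
      omega
  rw [measureReal_congr e, measureReal_biUnion_finset]
  · refine Finset.sum_congr rfl fun j _ => ?_
    have h3 := hind.measure_inter_preimage_eq_mul {(j : ℕ∞)} (Set.Iio ((t - j : ℕ) : ℕ∞))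
      (Set.to_countable _).measurableSet (Set.to_countable _).measurableSet
    have h4 := h.real_count_eq hlam.le hA hAb j
    have h5 := h.real_count_lt hlam.le hB hBb (t - j)
    rw [real_volume_closedBall hx, ← mul_assoc] at h4
    rw [real_volume_annulus hx hxy, ← mul_assoc] at h5
    rw [← h4, ← h5, Measure.real, Measure.real, Measure.real, ← ENNReal.toReal_mul]
    exact congrArg ENNReal.toReal h3
  · intro k _ l _ hkl
    refine Set.disjoint_left.2 fun ω h1 h2 => hkl ?_
    have : (k : ℕ∞) = l := h1.1.symm.trans h2.1
    exact_mod_cast this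
  · exact fun k _ => (h.measurableSet_count hA {(k : ℕ∞)}).inter
      (h.measurableSet_count hB (Set.Iio ((t - k : ℕ) : ℕ∞)))

end IsHPPP

/-! ### Joint survival function and joint density of two distances -/

lemma hasDerivAt_pow_succ_div_factorial {f : ℝ → ℝ} {f' x : ℝ} (hf : HasDerivAt f f' x) (n : ℕ) :
    HasDerivAt (fun x => f x ^ (n + 1) / ((n + 1)! : ℝ)) (f' * (f x ^ n / (n ! : ℝ))) x := by
  refine ((hf.pow (n + 1)).div_const _).congr_deriv ?_
  have : (n ! : ℝ) ≠ 0 := by positivity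
  rw [Nat.factorial_succ]
  push_cast
  field_simp

/-- A truncated binomial expansion along a curve `u + w = const` has a telescoping derivative. -/
lemma hasDerivAt_truncated_binomial {u w : ℝ → ℝ} {d x : ℝ} (hu : HasDerivAt u d x)
    (hw : HasDerivAt w (-d) x) (k r : ℕ) :
    HasDerivAt
      (fun x => ∑ j ∈ Finset.range (k + 1),
        u x ^ j / (j ! : ℝ) * (w x ^ (k + 1 + r - j) / ((k + 1 + r - j)! : ℝ)))
      (-(d * (u x ^ k / (k ! : ℝ) * (w x ^ r / (r ! : ℝ))))) x := by
  induction k generalizing r with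
  | zero =>
    have h := hasDerivAt_pow_succ_div_factorial hw r
    simpa [Nat.add_comm 1 r] using h
  | succ k ih =>
    have h1 := ih (r + 1)
    have h2 := (hasDerivAt_pow_succ_div_factorial hu k).mul
      (hasDerivAt_pow_succ_div_factorial hw r)
    have h3 := h1.add h2
    refine (h3.congr_deriv ?_).congr_of_eventuallyEq (Eventually.of_forall fun y => ?_)
    · ring
    · beta_reduce
      rw [Finset.sum_range_succ, show k + 1 + 1 + r = k + 1 + (r + 1) by ring,
        show k + 1 + (r + 1) - (k + 1) = r + 1 by omega]
      rfl

/-- Each new summand contributes a derivative whose positive part cancels what the earlier summands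
left, so only the last term survives. -/
lemma hasDerivAt_poissonLower (n : ℕ) (s : ℝ) :
    HasDerivAt (poissonLower (n + 1)) (-(Real.exp (-s) * (s ^ n / (n ! : ℝ)))) s := by
  have hexp : HasDerivAt (fun s : ℝ => Real.exp (-s)) (-Real.exp (-s)) s := by
    simpa using (hasDerivAt_neg s).exp
  induction n with
  | zero =>
    have e : poissonLower (0 + 1) = fun s => Real.exp (-s) := by
      ext s; simp [poissonLower]
    rw [e]
    simpa using hexp
  | succ n ih =>
    have h := ih.add (hexp.mul (hasDerivAt_pow_succ_div_factorial (hasDerivAt_id s) n))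
    refine (h.congr_deriv ?_).congr_of_eventuallyEq (Eventually.of_forall fun y => ?_)
    · simp only [id]; ring
    · simp only [poissonLower, Pi.add_apply, Pi.mul_apply, id]
      rw [Finset.sum_range_succ _ (n + 1), mul_div_assoc]

/-- The mass of `r_m > x` in the density of `r_t` at `y`, with `m = k + 1`, `t = k + r + 2` and
`c = λ π`. -/
def survivalDensity (c : ℝ) (k r : ℕ) (x y : ℝ) : ℝ :=
  2 * c * y * Real.exp (-(c * y ^ 2)) *
    ∑ j ∈ Finset.range (k + 1), (c * x ^ 2) ^ j / (j ! : ℝ) *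
      ((c * (y ^ 2 - x ^ 2)) ^ (k + 1 + r - j) / ((k + 1 + r - j)! : ℝ))

lemma survivalDensity_self (c : ℝ) (k r : ℕ) (y : ℝ) : survivalDensity c k r y y = 0 := by
  unfold survivalDensity
  rw [Finset.sum_eq_zero, mul_zero]
  intro j hj
  rw [Finset.mem_range] at hj
  rw [sub_self, mul_zero, zero_pow (by omega), zero_div, mul_zero]

lemma survivalDensity_nonneg {c : ℝ} (hc : 0 ≤ c) (k r : ℕ) {x y : ℝ} (hx : 0 ≤ x) (hxy : x ≤ y) :
    0 ≤ survivalDensity c k r x y := by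
  have hy : 0 ≤ y := hx.trans hxy
  have h : 0 ≤ y ^ 2 - x ^ 2 := by nlinarith
  unfold survivalDensity
  positivity

lemma Params.jointPdf_nonneg {p : Params} {lam : ℝ} (hlam : 0 ≤ lam) {m : ℕ} {x y : ℝ}
    (hx : 0 ≤ x) (hxy : x ≤ y) : 0 ≤ p.jointPdf lam m x y := by
  have hy : 0 ≤ y := hx.trans hxy
  have h : 0 ≤ y ^ 2 - x ^ 2 := by nlinarith
  unfold Params.jointPdf
  positivity

/-- Instance of the truncated binomial with u = cx² and w = c(y² - x²), whose sum does not depend on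
x. -/
lemma hasDerivAt_survivalDensity {p : Params} (lam : ℝ) {k r : ℕ} (ht : p.t = k + r + 2)
    (x y : ℝ) :
    HasDerivAt (fun x => survivalDensity (lam * Real.pi) k r x y)
      (-p.jointPdf lam (k + 1) x y) x := by
  have hu : HasDerivAt (fun x : ℝ => lam * Real.pi * x ^ 2) (2 * (lam * Real.pi) * x) x := by
    refine ((hasDerivAt_pow 2 x).const_mul _).congr_deriv ?_
    norm_num
    ring
  have hw : HasDerivAt (fun x : ℝ => lam * Real.pi * (y ^ 2 - x ^ 2))
      (-(2 * (lam * Real.pi) * x)) x := by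
    refine (((hasDerivAt_pow 2 x).const_sub (y ^ 2)).const_mul _).congr_deriv ?_
    norm_num
    ring
  refine ((hasDerivAt_truncated_binomial hu hw k r).const_mul
    (2 * (lam * Real.pi) * y * Real.exp (-(lam * Real.pi * y ^ 2)))).congr_deriv ?_
  unfold Params.jointPdf
  rw [ht, show k + r + 2 - (k + 1) - 1 = r by omega, show 2 * (k + 1) - 1 = 2 * k + 1 by omega,
    Nat.add_sub_cancel, mul_pow (lam * Real.pi) (y ^ 2 - x ^ 2)]
  field_simp
  ring

lemma continuous_jointPdf (p : Params) (lam : ℝ) (m : ℕ) :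
    Continuous fun z : ℝ × ℝ => p.jointPdf lam m z.1 z.2 := by
  unfold Params.jointPdf
  fun_prop

lemma integral_jointPdf {p : Params} (lam : ℝ) {k r : ℕ} (ht : p.t = k + r + 2) (x y : ℝ) :
    ∫ a in x..y, p.jointPdf lam (k + 1) a y = survivalDensity (lam * Real.pi) k r x y := by
  have hc : Continuous fun a => p.jointPdf lam (k + 1) a y :=
    (continuous_jointPdf p lam (k + 1)).comp (by fun_prop : Continuous fun a : ℝ => (a, y))
  have h := intervalIntegral.integral_eq_sub_of_hasDerivAt (a := x) (b := y)
    (f := fun x => -survivalDensity (lam * Real.pi) k r x y)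
    (f' := fun a => p.jointPdf lam (k + 1) a y)
    (fun a _ => by simpa using (hasDerivAt_survivalDensity lam ht a y).fun_neg)
    (hc.intervalIntegrable _ _)
  rw [h, survivalDensity_self]
  ring

/-- The joint survival function of `r_m` and `r_t` at `x ≤ y`. -/
def jointSurvival (c : ℝ) (k r : ℕ) (x y : ℝ) : ℝ :=
  ∑ j ∈ Finset.range (k + 1), Real.exp (-(c * x ^ 2)) * (c * x ^ 2) ^ j / (j ! : ℝ) *
    poissonLower (k + r + 2 - j) (c * (y ^ 2 - x ^ 2))

/-- Each Poisson tail differentiates to a single term, and the void probabilities of disc and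
annulus multiply to exp(-cy²), which factors out of the sum. -/
lemma hasDerivAt_jointSurvival (c : ℝ) (k r : ℕ) (x y : ℝ) :
    HasDerivAt (jointSurvival c k r x) (-survivalDensity c k r x y) y := by
  have hw : HasDerivAt (fun y : ℝ => c * (y ^ 2 - x ^ 2)) (2 * c * y) y := by
    refine (((hasDerivAt_pow 2 y).sub_const (x ^ 2)).const_mul _).congr_deriv ?_
    norm_num
    ring
  have h : ∀ j ∈ Finset.range (k + 1), HasDerivAt
      (fun y => Real.exp (-(c * x ^ 2)) * (c * x ^ 2) ^ j / (j ! : ℝ) *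
        poissonLower (k + r + 2 - j) (c * (y ^ 2 - x ^ 2)))
      (-(2 * c * y * Real.exp (-(c * y ^ 2)) * ((c * x ^ 2) ^ j / (j ! : ℝ) *
      ((c * (y ^ 2 - x ^ 2)) ^ (k + 1 + r - j) / ((k + 1 + r - j)! : ℝ))))) y := by
    intro j hj
    rw [Finset.mem_range] at hj
    rw [show k + r + 2 - j = (k + 1 + r - j) + 1 by omega]
    have h1 := ((hasDerivAt_poissonLower (k + 1 + r - j) _).comp y hw).const_mul
      (Real.exp (-(c * x ^ 2)) * (c * x ^ 2) ^ j / (j ! : ℝ))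
    refine h1.congr_deriv ?_
    have e : Real.exp (-(c * y ^ 2)) =
        Real.exp (-(c * x ^ 2)) * Real.exp (-(c * (y ^ 2 - x ^ 2))) := by
      rw [← Real.exp_add]
      congr 1
      ring
    rw [e]
    ring
  have h2 := HasDerivAt.fun_sum h
  rw [Finset.sum_neg_distrib, ← Finset.mul_sum] at h2
  exact h2

lemma tendsto_jointSurvival {c : ℝ} (hc : 0 < c) (k r : ℕ) (x : ℝ) :
    Tendsto (jointSurvival c k r x) atTop (𝓝 0) := by
  have hw : Tendsto (fun y : ℝ => c * (y ^ 2 - x ^ 2)) atTop atTop :=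
    Tendsto.const_mul_atTop hc (tendsto_atTop_add_const_right _ _ (tendsto_pow_atTop two_ne_zero))
  have h : ∀ j ∈ Finset.range (k + 1), Tendsto
      (fun y => Real.exp (-(c * x ^ 2)) * (c * x ^ 2) ^ j / (j ! : ℝ) *
        poissonLower (k + r + 2 - j) (c * (y ^ 2 - x ^ 2))) atTop (𝓝 0) := by
    intro j _
    simpa using ((tendsto_poissonLower (k + r + 2 - j)).comp hw).const_mul
      (Real.exp (-(c * x ^ 2)) * (c * x ^ 2) ^ j / (j ! : ℝ))
  have := tendsto_finsetSum _ h
  rw [Finset.sum_const_zero] at this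
  exact this

lemma lintegral_survivalDensity {c : ℝ} (hc : 0 < c) (k r : ℕ) {x y : ℝ} (hx : 0 ≤ x)
    (hxy : x ≤ y) :
    ∫⁻ b in Set.Ioi y, ENNReal.ofReal (survivalDensity c k r x b) =
      ENNReal.ofReal (jointSurvival c k r x y) := by
  have hd : ∀ b ∈ Set.Ici y, HasDerivAt (fun b => -jointSurvival c k r x b)
      (survivalDensity c k r x b) b :=
    fun b _ => by simpa using (hasDerivAt_jointSurvival c k r x b).fun_neg
  have hpos : ∀ b ∈ Set.Ioi y, 0 ≤ survivalDensity c k r x b :=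
    fun b hb => survivalDensity_nonneg hc.le k r hx (hxy.trans (le_of_lt hb))
  have hlim : Tendsto (fun b => -jointSurvival c k r x b) atTop (𝓝 0) := by
    simpa using (tendsto_jointSurvival hc k r x).neg
  have h1 := integral_Ioi_of_hasDerivAt_of_nonneg' hd hpos hlim
  have h2 := integrableOn_Ioi_deriv_of_nonneg' hd hpos hlim
  rw [← ofReal_integral_eq_lintegral_ofReal h2
    ((ae_restrict_iff' measurableSet_Ioi).2 (Eventually.of_forall hpos)), h1]
  simp

/-- The measure on the plane with density `f_{r_m, r_t}` on `0 < x < y`. -/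
def jointMeasure (p : Params) (lam : ℝ) (m : ℕ) : Measure (ℝ × ℝ) :=
  volume.withDensity ({z : ℝ × ℝ | 0 < z.1 ∧ z.1 < z.2}.indicator
    fun z => ENNReal.ofReal (p.jointPdf lam m z.1 z.2))

lemma measurableSet_wedge : MeasurableSet {z : ℝ × ℝ | 0 < z.1 ∧ z.1 < z.2} :=
  (measurableSet_lt measurable_const measurable_fst).inter
    (measurableSet_lt measurable_fst measurable_snd)

lemma ae_jointMeasure (p : Params) (lam : ℝ) (m : ℕ) :
    ∀ᵐ z ∂jointMeasure p lam m, 0 < z.1 ∧ z.1 < z.2 := by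
  rw [ae_iff]
  have h : MeasurableSet {z : ℝ × ℝ | ¬ (0 < z.1 ∧ z.1 < z.2)} := measurableSet_wedge.compl
  rw [jointMeasure, withDensity_apply _ h, setLIntegral_eq_zero_iff h
    ((continuous_jointPdf p lam m).measurable.ennreal_ofReal.indicator measurableSet_wedge)]
  exact Eventually.of_forall fun z hz =>
    Set.indicator_of_notMem (s := {z : ℝ × ℝ | 0 < z.1 ∧ z.1 < z.2}) hz _

/-- Tonelli, integrating over the smaller distance first. A constant ℓ yields quadrants, for
identifying the law; ℓ = g yields the outage region. -/
lemma jointMeasure_apply {p : Params} {lam : ℝ} (hlam : 0 ≤ lam) {k r : ℕ} (ht : p.t = k + r + 2)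
    {ℓ : ℝ → ℝ} (hℓ : Measurable ℓ) {B : Set ℝ} (hB : MeasurableSet B)
    (h0 : ∀ b ∈ B, 0 ≤ ℓ b) :
    jointMeasure p lam (k + 1) {z | z.2 ∈ B ∧ ℓ z.2 < z.1} =
      ∫⁻ b in B ∩ {b | ℓ b < b}, ENNReal.ofReal (survivalDensity (lam * Real.pi) k r (ℓ b) b) := by
  have hm : MeasurableSet {z : ℝ × ℝ | z.2 ∈ B ∧ ℓ z.2 < z.1} :=
    (measurable_snd hB).inter (measurableSet_lt (hℓ.comp measurable_snd) measurable_fst)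
  have hB' : MeasurableSet (B ∩ {b | ℓ b < b}) := hB.inter (measurableSet_lt hℓ measurable_id)
  have hd : Measurable fun z : ℝ × ℝ => ENNReal.ofReal (p.jointPdf lam (k + 1) z.1 z.2) :=
    (continuous_jointPdf p lam (k + 1)).measurable.ennreal_ofReal
  rw [jointMeasure, withDensity_apply _ hm, ← lintegral_indicator hm, Set.indicator_indicator,
    Measure.volume_eq_prod, lintegral_prod_symm' _ (hd.indicator (hm.inter measurableSet_wedge)),
    ← lintegral_indicator hB']
  refine lintegral_congr fun b => ?_
  -- The wedge excludes a = b, whereas `Ioc`, the form needed for interval integrals, includes it;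
  -- the exception is a null set.
  have e : ∀ a, ({z : ℝ × ℝ | z.2 ∈ B ∧ ℓ z.2 < z.1} ∩ {z : ℝ × ℝ | 0 < z.1 ∧ z.1 < z.2}).indicator
      (fun z => ENNReal.ofReal (p.jointPdf lam (k + 1) z.1 z.2)) (a, b) =
      (B ∩ {b | ℓ b < b}).indicator (fun b => (Set.Ioc (ℓ b) b).indicator
        (fun a => ENNReal.ofReal (p.jointPdf lam (k + 1) a b)) a) b ∨ a = b := by
    intro a
    by_cases hab : a = b
    · exact Or.inr hab
    refine Or.inl ?_
    by_cases hb : b ∈ B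
    · have h0 := h0 b hb
      by_cases h1 : ℓ b < a ∧ a < b
      · have m1 : (a, b) ∈ {z : ℝ × ℝ | z.2 ∈ B ∧ ℓ z.2 < z.1} ∩
            {z : ℝ × ℝ | 0 < z.1 ∧ z.1 < z.2} := ⟨⟨hb, h1.1⟩, h0.trans_lt h1.1, h1.2⟩
        have m2 : b ∈ B ∩ {b | ℓ b < b} := ⟨hb, h1.1.trans h1.2⟩
        have m3 : a ∈ Set.Ioc (ℓ b) b := ⟨h1.1, h1.2.le⟩
        rw [Set.indicator_of_mem m1, Set.indicator_of_mem m2, Set.indicator_of_mem m3]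
      · rw [Set.indicator_of_notMem fun h => h1 ⟨h.1.2, h.2.2⟩]
        refine (Set.indicator_apply_eq_zero.2 fun _ => ?_).symm
        exact Set.indicator_of_notMem
          (fun h => h1 ⟨h.1, lt_of_le_of_ne h.2 hab⟩) _
    · rw [Set.indicator_of_notMem fun h => hb h.1.1, Set.indicator_of_notMem fun h => hb h.1]
  have e2 : (fun a => ({z : ℝ × ℝ | z.2 ∈ B ∧ ℓ z.2 < z.1} ∩
      {z : ℝ × ℝ | 0 < z.1 ∧ z.1 < z.2}).indicator
      (fun z => ENNReal.ofReal (p.jointPdf lam (k + 1) z.1 z.2)) (a, b)) =ᵐ[volume]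
      fun a => (B ∩ {b | ℓ b < b}).indicator (fun b => (Set.Ioc (ℓ b) b).indicator
        (fun a => ENNReal.ofReal (p.jointPdf lam (k + 1) a b)) a) b := by
    filter_upwards [compl_mem_ae_iff.2 (measure_singleton (μ := (volume : Measure ℝ)) b)] with a ha
    exact (e a).resolve_right ha
  rw [lintegral_congr_ae e2]
  by_cases hb : b ∈ B ∩ {b | ℓ b < b}
  · simp only [Set.indicator_of_mem hb]
    have hlt : ℓ b ≤ b := le_of_lt hb.2
    have hc : Continuous fun a => p.jointPdf lam (k + 1) a b :=
      (continuous_jointPdf p lam (k + 1)).comp (by fun_prop : Continuous fun a : ℝ => (a, b))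
    rw [lintegral_indicator measurableSet_Ioc, ← ofReal_integral_eq_lintegral_ofReal,
      ← intervalIntegral.integral_of_le hlt, integral_jointPdf lam ht]
    · exact (hc.integrableOn_Icc).mono_set Set.Ioc_subset_Icc_self
    · refine (ae_restrict_iff' measurableSet_Ioc).2 (Eventually.of_forall fun a ha => ?_)
      exact Params.jointPdf_nonneg hlam ((h0 b hb.1).trans ha.1.le) ha.2
  · simp only [Set.indicator_of_notMem hb, lintegral_zero]

lemma jointMeasure_Ioi_prod_Ioi {p : Params} {lam : ℝ} (hlam : 0 < lam) {k r : ℕ}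
    (ht : p.t = k + r + 2) {x y : ℝ} (hx : 0 ≤ x) (hxy : x ≤ y) :
    jointMeasure p lam (k + 1) (Set.Ioi x ×ˢ Set.Ioi y) =
      ENNReal.ofReal (jointSurvival (lam * Real.pi) k r x y) := by
  have h := jointMeasure_apply hlam.le ht (measurable_const (a := x)) (measurableSet_Ioi (a := y))
    (fun _ _ => hx)
  have e : Set.Ioi y ∩ {b | x < b} = Set.Ioi y :=
    Set.inter_eq_left.2 fun b hb => hxy.trans_lt hb
  rw [e, lintegral_survivalDensity (by positivity) k r hx hxy] at h
  rw [← h]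
  congr 1
  ext z
  exact and_comm

lemma ext_of_Ioi_prod_Ioi {μ ν : Measure (ℝ × ℝ)} [IsFiniteMeasure μ]
    (huniv : μ Set.univ = ν Set.univ)
    (h : ∀ x y, μ (Set.Ioi x ×ˢ Set.Ioi y) = ν (Set.Ioi x ×ˢ Set.Ioi y)) : μ = ν := by
  have hgen : MeasurableSpace.generateFrom (Set.range (Set.Ioi : ℝ → Set ℝ)) =
      (inferInstance : MeasurableSpace ℝ) := by
    rw [← borel_eq_generateFrom_Ioi]
    exact (BorelSpace.measurable_eq (α := ℝ)).symm
  have hspan : IsCountablySpanning (Set.range (Set.Ioi : ℝ → Set ℝ)) := by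
    refine ⟨fun n : ℕ => Set.Ioi (-(n : ℝ)), fun n => ⟨_, rfl⟩, Set.eq_univ_of_forall fun x => ?_⟩
    obtain ⟨n, hn⟩ := exists_nat_gt (-x)
    exact Set.mem_iUnion.2 ⟨n, neg_lt.1 hn⟩
  have hpi : IsPiSystem (Set.range (Set.Ioi : ℝ → Set ℝ)) := isPiSystem_Ioi
  refine ext_of_generate_finite _ (generateFrom_eq_prod hgen hgen hspan hspan).symm
    (hpi.prod hpi) ?_ huniv
  rintro _ ⟨_, ⟨x, rfl⟩, _, ⟨y, rfl⟩, rfl⟩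
  exact h x y

/-- The joint law of the distances to the `m`-th and the `t`-th nearest points. -/
lemma IsHPPP.map_nearestDist {Ω : Type*} [MeasurableSpace Ω] {P : Measure Ω}
    [IsProbabilityMeasure P] {Φ : Ω → Set Plane} {lam : ℝ} (h : IsHPPP P Φ lam) (hlam : 0 < lam)
    {p : Params} {k r : ℕ} (ht : p.t = k + r + 2) :
    P.map (fun ω => (nearestDist (Φ ω) (k + 1), nearestDist (Φ ω) p.t)) =
      jointMeasure p lam (k + 1) := by
  have haem : AEMeasurable (fun ω => (nearestDist (Φ ω) (k + 1), nearestDist (Φ ω) p.t)) P :=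
    (h.aemeasurable_nearestDist hlam _).prodMk (h.aemeasurable_nearestDist hlam _)
  set μ := P.map (fun ω => (nearestDist (Φ ω) (k + 1), nearestDist (Φ ω) p.t)) with hμ
  have : IsProbabilityMeasure μ := Measure.isProbabilityMeasure_map haem
  have hae : ∀ᵐ z ∂μ, 0 < z.1 ∧ z.1 ≤ z.2 := by
    have hms : MeasurableSet {z : ℝ × ℝ | 0 < z.1 ∧ z.1 ≤ z.2} :=
      (measurableSet_lt measurable_const measurable_fst).inter
        (measurableSet_le measurable_fst measurable_snd)
    rw [hμ, ae_map_iff haem hms]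
    filter_upwards [h.ae_nearestDist_pos hlam, h.ae_nearestDist_mono hlam] with ω h1 h2
    exact ⟨h1 _ (by omega), h2 (by omega)⟩
  have hae' : ∀ᵐ z ∂jointMeasure p lam (k + 1), 0 < z.1 ∧ z.1 ≤ z.2 :=
    (ae_jointMeasure p lam (k + 1)).mono fun z hz => ⟨hz.1, hz.2.le⟩
  have hquad : ∀ x y, μ (Set.Ioi x ×ˢ Set.Ioi y) =
      jointMeasure p lam (k + 1) (Set.Ioi x ×ˢ Set.Ioi y) := by
    -- Both measures are carried by 0 < z.1 ≤ z.2, where an arbitrary quadrant agrees with the one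
    -- at corner (max x 0, max y (max x 0)).
    suffices h0 : ∀ x y, 0 ≤ x → x ≤ y → μ (Set.Ioi x ×ˢ Set.Ioi y) =
        jointMeasure p lam (k + 1) (Set.Ioi x ×ˢ Set.Ioi y) by
      intro x y
      have hred : ∀ z : ℝ × ℝ, 0 < z.1 ∧ z.1 ≤ z.2 →
          (z ∈ Set.Ioi x ×ˢ Set.Ioi y ↔
            z ∈ Set.Ioi (max x 0) ×ˢ Set.Ioi (max y (max x 0))) := by
        rintro ⟨a, b⟩ ⟨ha, hab⟩
        simp only [Set.mem_prod, Set.mem_Ioi, max_lt_iff] at *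
        constructor
        · rintro ⟨h1, h2⟩
          exact ⟨⟨h1, ha⟩, h2, h1.trans_le hab, ha.trans_le hab⟩
        · rintro ⟨⟨h1, -⟩, h2, -⟩
          exact ⟨h1, h2⟩
      rw [measure_congr (eventuallyEq_set.2 (hae.mono hred)),
        measure_congr (eventuallyEq_set.2 (hae'.mono hred))]
      exact h0 _ _ (le_max_right _ _) (le_max_right _ _)
    intro x y hx hxy
    have h1 := h.real_lt_nearestDist_and_lt hlam hx hxy (m := k + 1) (t := p.t) (by omega)
    rw [jointMeasure_Ioi_prod_Ioi hlam ht hx hxy, hμ,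
      Measure.map_apply_of_aemeasurable haem (measurableSet_Ioi.prod measurableSet_Ioi),
      jointSurvival, ← ht, ← h1, ofReal_measureReal]
    rfl
  refine ext_of_Ioi_prod_Ioi ?_ hquad
  have e : ∀ z : ℝ × ℝ, 0 < z.1 ∧ z.1 ≤ z.2 →
      (z ∈ (Set.univ : Set (ℝ × ℝ)) ↔ z ∈ Set.Ioi (0 : ℝ) ×ˢ Set.Ioi (0 : ℝ)) :=
    fun z hz => iff_of_true trivial ⟨hz.1, hz.1.trans_le hz.2⟩
  rw [measure_congr (eventuallyEq_set.2 (hae.mono e)),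
    measure_congr (eventuallyEq_set.2 (hae'.mono e))]
  exact hquad 0 0

/-! ### Convergence of Chebyshev–Gauss quadrature -/

/-- Convergence of the composite midpoint rule. -/
lemma tendsto_midpoint_sum {h : ℝ → ℝ} (hh : Continuous h) {L : ℝ} (hL : 0 ≤ L) :
    Tendsto (fun N : ℕ => ∑ k ∈ Finset.range N,
      L / N * h ((2 * (k : ℝ) + 1) / (2 * (N : ℝ)) * L)) atTop (𝓝 (∫ θ in 0..L, h θ)) := by
  rw [Metric.tendsto_atTop]
  intro e he
  have huc := (isCompact_Icc (a := (0 : ℝ)) (b := L)).uniformContinuousOn_of_continuous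
    hh.continuousOn
  rw [Metric.uniformContinuousOn_iff] at huc
  -- Dividing by L + 1 rather than L covers L = 0 and makes the total error eL/(L + 1) strictly less
  -- than e.
  obtain ⟨δ, hδ, hu⟩ := huc (e / (L + 1)) (by positivity)
  obtain ⟨N₀, hN₀⟩ := exists_nat_gt (L / δ)
  refine ⟨N₀ + 1, fun N hN => ?_⟩
  have hN1 : (N₀ : ℝ) + 1 ≤ N := by exact_mod_cast hN
  have hNpos : (0 : ℝ) < N := by linarith [(Nat.cast_nonneg N₀ : (0 : ℝ) ≤ N₀)]
  have hmesh : L / N < δ := by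
    rw [div_lt_iff₀ hNpos]
    rw [div_lt_iff₀ hδ] at hN₀
    nlinarith
  have hsplit : ∫ θ in 0..L, h θ =
      ∑ k ∈ Finset.range N, ∫ θ in ((k : ℕ) : ℝ) * (L / N)..((k + 1 : ℕ) : ℝ) * (L / N), h θ := by
    rw [intervalIntegral.sum_integral_adjacent_intervals (a := fun k : ℕ => (k : ℝ) * (L / N))
      fun k _ => hh.intervalIntegrable _ _]
    congr 1
    · simp
    · field_simp
  have hmono : 0 ≤ L / N := by positivity
  have hterm : ∀ k ∈ Finset.range N,
      |L / N * h ((2 * (k : ℝ) + 1) / (2 * (N : ℝ)) * L) -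
        ∫ θ in ((k : ℕ) : ℝ) * (L / N)..((k + 1 : ℕ) : ℝ) * (L / N), h θ| ≤
          e / (L + 1) * (L / N) := by
    intro k hk
    have hkN : (k : ℝ) + 1 ≤ N := by exact_mod_cast Finset.mem_range.1 hk
    set c := (2 * (k : ℝ) + 1) / (2 * (N : ℝ)) * L with hc
    have hc' : c = (k + 1 / 2) * (L / N) := by
      rw [hc]
      field_simp
    have hlen : ((k + 1 : ℕ) : ℝ) * (L / N) - (k : ℝ) * (L / N) = L / N := by
      push_cast
      ring
    have hend : ((k : ℝ) + 1) * (L / N) ≤ L := by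
      calc ((k : ℝ) + 1) * (L / N) ≤ N * (L / N) := by gcongr
        _ = L := by field_simp
    have e1 : L / N * h c = ∫ _ in (k : ℝ) * (L / N)..((k + 1 : ℕ) : ℝ) * (L / N), h c := by
      rw [intervalIntegral.integral_const, hlen, smul_eq_mul]
    rw [e1, ← intervalIntegral.integral_sub (by simp) (hh.intervalIntegrable _ _),
      ← Real.norm_eq_abs]
    have hb := intervalIntegral.norm_integral_le_of_norm_le_const
      (a := (k : ℝ) * (L / N)) (b := ((k + 1 : ℕ) : ℝ) * (L / N)) (f := fun θ => h c - h θ)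
      (C := e / (L + 1)) ?_
    · rwa [hlen, abs_of_nonneg hmono] at hb
    · intro θ hθ
      rw [Set.uIoc_of_le (by linarith)] at hθ
      have h1 := hθ.1
      have h2 := hθ.2
      push_cast at h2
      have hk0 : 0 ≤ (k : ℝ) * (L / N) := by positivity
      rw [← dist_eq_norm]
      refine (hu c ⟨by rw [hc']; positivity, by rw [hc']; nlinarith⟩ θ
        ⟨by linarith, by linarith⟩ ?_).le
      rw [Real.dist_eq, abs_lt, hc']
      constructor <;> nlinarith
  rw [Real.dist_eq, hsplit, ← Finset.sum_sub_distrib]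
  calc |_| ≤ ∑ k ∈ Finset.range N, e / (L + 1) * (L / N) :=
        (Finset.abs_sum_le_sum_abs _ _).trans (Finset.sum_le_sum hterm)
    _ = e * (L / (L + 1)) := by
        rw [Finset.sum_const, Finset.card_range, nsmul_eq_mul]
        field_simp
    _ < e := mul_lt_of_lt_one_right he ((div_lt_one (by positivity)).2 (by linarith))

/-- Substitution along the cosine; it runs from b down to a, and the reversal absorbs the sign of
-sin. -/
lemma integral_comp_cos {f : ℝ → ℝ} (hf : Continuous f) (a b : ℝ) :
    ∫ θ in 0..Real.pi, (b - a) / 2 * f ((b - a) / 2 * Real.cos θ + (b + a) / 2) * Real.sin θ =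
      ∫ y in a..b, f y := by
  have h := intervalIntegral.integral_comp_mul_deriv (a := 0) (b := Real.pi)
    (f := fun θ => (b - a) / 2 * Real.cos θ + (b + a) / 2)
    (f' := fun θ => (b - a) / 2 * -Real.sin θ) (g := f)
    (fun θ _ => ((Real.hasDerivAt_cos θ).const_mul _).add_const _) (by fun_prop) hf
  simp only [Function.comp_def, Real.cos_zero, Real.cos_pi] at h
  rw [show (b - a) / 2 * 1 + (b + a) / 2 = b by ring,
    show (b - a) / 2 * -1 + (b + a) / 2 = a by ring, intervalIntegral.integral_symm a b] at h
  rw [← neg_inj, ← h, ← intervalIntegral.integral_neg]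
  congr 1
  ext θ
  ring

lemma chebNode_mem_Icc {a b : ℝ} (hab : a ≤ b) (N l : ℕ) :
    (b - a) / 2 * chebNode N l + (b + a) / 2 ∈ Set.Icc a b := by
  have h1 := Real.neg_one_le_cos ((2 * (l : ℝ) - 1) / (2 * (N : ℝ)) * Real.pi)
  have h2 := Real.cos_le_one ((2 * (l : ℝ) - 1) / (2 * (N : ℝ)) * Real.pi)
  unfold chebNode
  constructor <;> nlinarith

/-- Chebyshev-Gauss quadrature converges for continuous functions. -/
lemma tendsto_chebGauss {f : ℝ → ℝ} {a b : ℝ} (hab : a ≤ b) (hf : ContinuousOn f (Set.Icc a b)) :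
    Tendsto (fun N => chebGauss N f a b) atTop (𝓝 (∫ y in a..b, f y)) := by
  -- The midpoint rule is stated for globally continuous functions; the extension changes neither
  -- the integral nor the values at the nodes, which lie in [a, b].
  set F : ℝ → ℝ := Set.IccExtend hab ((Set.Icc a b).domRestrict f) with hF
  have hFc : Continuous F := (continuousOn_iff_continuous_domRestrict.1 hf).Icc_extend'
  have hFf : ∀ y ∈ Set.Icc a b, F y = f y := fun y hy => Set.IccExtend_of_mem hab _ hy
  have hint : ∫ y in a..b, f y = ∫ y in a..b, F y := by
    refine intervalIntegral.integral_congr fun y hy => (hFf y ?_).symm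
    rwa [Set.uIcc_of_le hab] at hy
  rw [hint, ← integral_comp_cos hFc a b]
  refine (tendsto_midpoint_sum (by fun_prop) Real.pi_nonneg).congr fun N => ?_
  -- With l = k + 1 the angle (2l - 1)π/(2N) is the k-th midpoint on [0, π], and the square root is
  -- its sine.
  have hIcc : Finset.Icc 1 N = Finset.Ico (0 + 1) (N + 1) := by
    ext
    simp only [Finset.mem_Icc, Finset.mem_Ico]
    omega
  rw [chebGauss, hIcc, ← Finset.sum_Ico_add', ← Finset.range_eq_Ico]
  refine Finset.sum_congr rfl fun k hk => ?_
  have hkN : (k : ℝ) + 1 ≤ N := by exact_mod_cast Finset.mem_range.1 hk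
  have hN : (0 : ℝ) < N := by linarith [(Nat.cast_nonneg k : (0 : ℝ) ≤ k)]
  rw [← hFf _ (chebNode_mem_Icc hab N (k + 1)), chebNode]
  push_cast
  rw [show 2 * ((k : ℝ) + 1) - 1 = 2 * k + 1 by ring, ← Real.abs_sin_eq_sqrt_one_sub_cos_sq,
    abs_of_nonneg]
  · field_simp
  · refine Real.sin_nonneg_of_nonneg_of_le_pi (by positivity) ?_
    refine mul_le_of_le_one_left Real.pi_nonneg ?_
    rw [div_le_one (by positivity)]
    linarith

/-! ### Binomial expansion and evaluation of the outage probabilities -/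

namespace Params

variable {p : Params}

lemma continuousOn_fm (hα : 0 < p.α) (hρ : 0 < p.ρ) (hε : 0 < p.ε 1) {i : ℕ} (hφ : 0 < p.phi i)
    (lam : ℝ) (m q : ℕ) : ContinuousOn (p.fm lam m i q) (Set.Icc (p.tau₁ i) p.tau₂) := by
  have hg : ContinuousOn (p.g i) (Set.Icc (p.tau₁ i) p.tau₂) :=
    (continuousOn_g hα hρ hε hφ).mono (Set.Icc_subset_Icc_left (tau₁_nonneg hρ hε hφ))
  unfold fm
  fun_prop

/-- The binomial expansion of the inner integral. -/
lemma integral_jointPdf_eq_sum_fm (lam : ℝ) {k r : ℕ} (ht : p.t = k + r + 2) (i : ℕ) (y : ℝ) :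
    ∫ x in (p.g i y)..y, p.jointPdf lam (k + 1) x y =
      4 * (lam * Real.pi) ^ p.t / ((r ! : ℝ) * (k ! : ℝ)) *
        ∑ q ∈ Finset.range (r + 1), (-1 : ℝ) ^ q * (r.choose q : ℝ) * p.fm lam (k + 1) i q y := by
  have e : ∀ x, p.jointPdf lam (k + 1) x y = ∑ q ∈ Finset.range (r + 1),
      4 * (lam * Real.pi) ^ p.t / ((r ! : ℝ) * (k ! : ℝ)) * ((-1 : ℝ) ^ q * (r.choose q : ℝ) *
        (Real.exp (-(lam * Real.pi * y ^ 2)) * y ^ (2 * r - 2 * q + 1))) *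
          x ^ (2 * k + 2 * q + 1) := by
    intro x
    rw [jointPdf, show p.t - (k + 1) - 1 = r by omega, show 2 * (k + 1) - 1 = 2 * k + 1 by omega,
      Nat.add_sub_cancel, show y ^ 2 - x ^ 2 = -x ^ 2 + y ^ 2 by ring, add_pow, Finset.mul_sum,
      Finset.sum_div, Finset.mul_sum]
    refine Finset.sum_congr rfl fun q hq => ?_
    have hq' := Finset.mem_range_succ_iff.1 hq
    rw [neg_pow, ← pow_mul, ← pow_mul, show 2 * (r - q) = 2 * r - 2 * q by omega]
    field_simp
    ring
  simp only [e]
  rw [intervalIntegral.integral_finsetSum, Finset.mul_sum]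
  · refine Finset.sum_congr rfl fun q _ => ?_
    rw [intervalIntegral.integral_const_mul, integral_pow, fm,
      show p.t - (k + 1) - 1 = r by omega, show 2 * (k + 1) + 2 * q = 2 * k + 2 * q + 1 + 1 by ring]
    push_cast
    rw [show (2 * (k : ℝ) + 2 * q + 1 + 1) = 2 * ((k : ℝ) + 1) + 2 * q by ring]
    ring
  · exact fun q _ => (by fun_prop : Continuous _).intervalIntegrable _ _

end Params

lemma poissonLower_mul_rpow (c α : ℝ) {b : ℝ} (hb : 0 ≤ b) (n : ℕ) :
    poissonLower n (c * (b ^ α⁻¹) ^ 2) =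
      Real.exp (-(c * b ^ (2 / α))) *
        ∑ k ∈ Finset.range n, c ^ k * b ^ (2 * (k : ℝ) / α) / (k ! : ℝ) := by
  have e : ∀ k : ℕ, (b ^ α⁻¹) ^ k = b ^ ((k : ℝ) / α) := fun k => by
    rw [← Real.rpow_natCast, ← Real.rpow_mul hb, div_eq_inv_mul]
  rw [poissonLower, Finset.mul_sum]
  refine Finset.sum_congr rfl fun k _ => ?_
  rw [mul_pow, ← pow_mul, e, e]
  push_cast
  rw [mul_div_assoc]

namespace Params

variable {Ω : Type*} [MeasurableSpace Ω] {P : Measure Ω} [IsProbabilityMeasure P]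
  {Φ : Ω → Set Plane} {lam : ℝ} {p : Params}

lemma outageProb_one (hΦ : IsHPPP P Φ lam) (hlam : 0 < lam) (hα : 0 < p.α) (hρ : 0 < p.ρ)
    (hε : 0 < p.ε 1) (hβ : ∑ j ∈ Finset.Icc 2 p.M, p.β j = 1) {n : ℕ} (hn : 1 ≤ n)
    (hnt : n ≤ p.t) :
    p.outageProb P Φ n 1 = P.real {ω | p.tau₂ < nearestDist (Φ ω) n} := by
  refine measureReal_congr (eventuallyEq_set.2 ?_)
  filter_upwards [hΦ.ae_nearestDist_pos hlam, hΦ.ae_nearestDist_mono hlam] with ω h1 h2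
  rw [decodes_one_iff hα hρ hε hβ (h1 n hn) (h2 hnt), not_le, tau₂_eq hρ hε]

lemma outageProb_self (hΦ : IsHPPP P Φ lam) (hlam : 0 < lam) (hα : 0 < p.α) (hρ : 0 < p.ρ)
    (hR : ∀ l ∈ Finset.Icc 1 p.M, 0 < p.R l) (hβ : ∑ j ∈ Finset.Icc 2 p.M, p.β j = 1)
    (hξ : ∀ j ∈ Finset.Icc 2 p.M, 0 < p.xiBar j) (ht : 1 ≤ p.t) {i : ℕ} (hi : 2 ≤ i)
    (hiM : i ≤ p.M) :
    p.outageProb P Φ p.t i = P.real {ω |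
      (1 / (p.ε 1 / p.ρ + (1 + p.ε 1) / (p.ρ * p.phi i))) ^ p.α⁻¹ <
        nearestDist (Φ ω) p.t} := by
  refine measureReal_congr (eventuallyEq_set.2 ?_)
  filter_upwards [hΦ.ae_nearestDist_pos hlam] with ω h1
  rw [decodes_self_iff hα hρ hR hβ hξ hi hiM (h1 _ ht), not_le]

lemma measurable_g (p : Params) (i : ℕ) : Measurable (p.g i) := by
  unfold g
  fun_prop

/-- The outage event at a closer server splits into outage of `f_1` at the `t`-th server and a
region of the plane of the two distances. -/
lemma outageProb_eq_add_measure (hΦ : IsHPPP P Φ lam) (hlam : 0 < lam) (hα : 0 < p.α)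
    (hρ : 0 < p.ρ) (hR : ∀ l ∈ Finset.Icc 1 p.M, 0 < p.R l)
    (hβ : ∑ j ∈ Finset.Icc 2 p.M, p.β j = 1) (hξ : ∀ j ∈ Finset.Icc 2 p.M, 0 < p.xiBar j)
    {k r : ℕ} (ht : p.t = k + r + 2) {i : ℕ} (hi : 2 ≤ i) (hiM : i ≤ p.M) :
    p.outageProb P Φ (k + 1) i = p.outageProb P Φ p.t 1 +
      (jointMeasure p lam (k + 1)).real {z | z.2 ∈ Set.Ioc 0 p.tau₂ ∧ p.g i z.2 < z.1} := by
  have hε : 0 < p.ε 1 := ε_pos (hR 1 (Finset.mem_Icc.2 ⟨le_rfl, by omega⟩))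
  have hat := hΦ.aemeasurable_nearestDist hlam p.t
  have ham := hΦ.aemeasurable_nearestDist hlam (k + 1)
  have hD : MeasurableSet {z : ℝ × ℝ | z.2 ∈ Set.Ioc 0 p.tau₂ ∧ p.g i z.2 < z.1} :=
    (measurable_snd measurableSet_Ioc).inter
      (measurableSet_lt ((p.measurable_g i).comp measurable_snd) measurable_fst)
  have hnull := (ham.prodMk hat).nullMeasurableSet_preimage hD
  rw [outageProb_one hΦ hlam hα hρ hε hβ (by omega) le_rfl, ← hΦ.map_nearestDist hlam ht,
    Measure.real, Measure.real, Measure.map_apply_of_aemeasurable (ham.prodMk hat) hD]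
  change _ = P.real _ + P.real _
  rw [← measureReal_union₀ hnull]
  · refine measureReal_congr (eventuallyEq_set.2 ?_)
    filter_upwards [hΦ.ae_nearestDist_pos hlam, hΦ.ae_nearestDist_mono hlam] with ω h1 h2
    change ¬ p.Decodes (Φ ω) (k + 1) i ↔ (p.tau₂ < nearestDist (Φ ω) p.t ∨
      ((0 < nearestDist (Φ ω) p.t ∧ nearestDist (Φ ω) p.t ≤ p.tau₂) ∧
        p.g i (nearestDist (Φ ω) p.t) < nearestDist (Φ ω) (k + 1)))
    rw [decodes_iff hα hρ hR hβ hξ hi hiM (h1 _ (by omega)) (h2 (by omega))]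
    have h3 : 0 < nearestDist (Φ ω) p.t := h1 _ (by omega)
    simp only [h3, true_and, ← not_le]
    tauto
  · refine Disjoint.aedisjoint (Set.disjoint_left.2 fun ω h1 h2 => ?_)
    exact (lt_of_lt_of_le (show p.tau₂ < nearestDist (Φ ω) p.t from h1) h2.1.2).false

/-- For y in (0, τ₂] the section g(y) < x < y is nonempty exactly when y > τ₁, so the outer range
shrinks to (τ₁, τ₂]. -/
lemma jointMeasure_real_eq_integral (hlam : 0 < lam) (hα : 0 < p.α) (hρ : 0 < p.ρ)
    (hε : 0 < p.ε 1) {i : ℕ} (hφ : 0 < p.phi i) {k r : ℕ} (ht : p.t = k + r + 2) :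
    (jointMeasure p lam (k + 1)).real {z | z.2 ∈ Set.Ioc 0 p.tau₂ ∧ p.g i z.2 < z.1} =
      ∫ y in (p.tau₁ i)..p.tau₂, ∫ x in (p.g i y)..y, p.jointPdf lam (k + 1) x y := by
  have h0 := tau₁_nonneg hρ hε hφ
  have h12 := tau₁_le_tau₂ hα hρ hε hφ
  have hg0 : ∀ b ∈ Set.Ioc 0 p.tau₂, 0 ≤ p.g i b := fun b hb =>
    g_nonneg hε hφ ((le_tau₂_iff hα hρ hε hb.1.le).1 hb.2)
  have hset : Set.Ioc 0 p.tau₂ ∩ {b | p.g i b < b} = Set.Ioc (p.tau₁ i) p.tau₂ := by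
    ext b
    constructor
    · rintro ⟨hb, hb'⟩
      exact ⟨(g_lt_self_iff hα hρ hε hφ hb.1.le hb.2).1 hb', hb.2⟩
    · intro hb
      have hb0 : 0 < b := h0.trans_lt hb.1
      exact ⟨⟨hb0, hb.2⟩, (g_lt_self_iff hα hρ hε hφ hb0.le hb.2).2 hb.1⟩
  have hcont : ContinuousOn (fun y => ∫ x in (p.g i y)..y, p.jointPdf lam (k + 1) x y)
      (Set.Icc (p.tau₁ i) p.tau₂) := by
    simp only [integral_jointPdf_eq_sum_fm lam ht]
    exact continuousOn_const.mul (continuousOn_finsetSum _ fun q _ =>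
      continuousOn_const.mul (continuousOn_fm hα hρ hε hφ lam (k + 1) q))
  rw [Measure.real, jointMeasure_apply hlam.le ht (p.measurable_g i) measurableSet_Ioc hg0, hset,
    intervalIntegral.integral_of_le h12, integral_eq_lintegral_of_nonneg_ae]
  · simp only [integral_jointPdf lam ht]
  · refine (ae_restrict_iff' measurableSet_Ioc).2 (Eventually.of_forall fun b hb => ?_)
    have hb0 : 0 < b := h0.trans_lt hb.1
    change 0 ≤ ∫ x in (p.g i b)..b, p.jointPdf lam (k + 1) x b
    rw [integral_jointPdf lam ht]
    exact survivalDensity_nonneg (by positivity) k r (hg0 b ⟨hb0, hb.2⟩)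
      ((g_lt_self_iff hα hρ hε hφ hb0.le hb.2).2 hb.1).le
  · exact (hcont.mono Set.Ioc_subset_Icc_self).aestronglyMeasurable measurableSet_Ioc

end Params

end ContentPush

end

theorem lemma2 {Ω : Type*} [MeasurableSpace Ω] (P : Measure Ω) [IsProbabilityMeasure P]
    (Φ : Ω → Set ContentPush.Plane) (lam : ℝ) (hlam : 0 < lam)
    (hΦ : ContentPush.IsHPPP P Φ lam)
    (p : ContentPush.Params) (hα : 0 < p.α) (hρ : 0 < p.ρ)
    (hR : ∀ l ∈ Finset.Icc 1 p.M, 0 < p.R l)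
    (hβ : ∑ j ∈ Finset.Icc 2 p.M, p.β j = 1)
    (hξ : ∀ j ∈ Finset.Icc 2 p.M, 0 < p.xiBar j)
    (hε : p.ε 1 ≤ p.ε p.M) :
    -- decoding `f_1`
    (∀ n : ℕ, 1 ≤ n → n ≤ p.t →
      p.outageProb P Φ n 1 =
        Real.exp (-(lam * Real.pi * (p.ρ / p.ε 1) ^ (2 / p.α))) *
          ∑ k ∈ Finset.range n,
            (lam * Real.pi) ^ k * (p.ρ / p.ε 1) ^ (2 * (k : ℝ) / p.α) / (k ! : ℝ)) ∧
    -- decoding `f_i`, `2 ≤ i`, at the `t`-th nearest content server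
    (1 ≤ p.t → ∀ i : ℕ, 2 ≤ i → i ≤ p.M →
      p.outageProb P Φ p.t i =
        Real.exp (-(lam * Real.pi *
            (p.ε 1 / p.ρ + (1 + p.ε 1) / (p.ρ * p.phi i)) ^ (-(2 / p.α)))) *
          ∑ k ∈ Finset.range p.t,
            (lam * Real.pi) ^ k *
              (p.ε 1 / p.ρ + (1 + p.ε 1) / (p.ρ * p.phi i)) ^ (-(2 * (k : ℝ) / p.α)) /
              (k ! : ℝ)) ∧
    -- decoding `f_i`, `2 ≤ i`, at the `m`-th nearest content server, `m < t`
    (∀ m : ℕ, 1 ≤ m → m < p.t → ∀ i : ℕ, 2 ≤ i → i ≤ p.M →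
      p.outageProb P Φ m i =
          p.outageProb P Φ p.t 1 +
            ∫ y in (p.tau₁ i)..p.tau₂, ∫ x in (p.g i y)..y, p.jointPdf lam m x y ∧
      (∀ q ∈ Finset.range (p.t - m),
        IntervalIntegrable (p.fm lam m i q) volume (p.tau₁ i) p.tau₂) ∧
      p.outageProb P Φ m i =
          p.outageProb P Φ p.t 1 +
            4 * (lam * Real.pi) ^ p.t / (((p.t - m - 1)! : ℝ) * ((m - 1)! : ℝ)) *
              ∑ q ∈ Finset.range (p.t - m),
                (-1 : ℝ) ^ q * ((p.t - m - 1).choose q : ℝ) *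
                  ∫ y in (p.tau₁ i)..p.tau₂, p.fm lam m i q y ∧
      Tendsto
        (fun N : ℕ => p.outageProb P Φ p.t 1 +
          4 * (lam * Real.pi) ^ p.t / (((p.t - m - 1)! : ℝ) * ((m - 1)! : ℝ)) *
            ∑ q ∈ Finset.range (p.t - m),
              (-1 : ℝ) ^ q * ((p.t - m - 1).choose q : ℝ) *
                ContentPush.chebGauss N (p.fm lam m i q) (p.tau₁ i) p.tau₂)
        atTop (𝓝 (p.outageProb P Φ m i))) := by
  have hM : 2 ≤ p.M := by
    by_contra! h
    rw [Finset.Icc_eq_empty (by omega), Finset.sum_empty] at hβ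
    exact zero_ne_one hβ
  have hε1 : 0 < p.ε 1 :=
    ContentPush.Params.ε_pos (hR 1 (Finset.mem_Icc.2 ⟨le_rfl, by omega⟩))
  refine ⟨fun n hn hnt => ?_, fun ht i hi hiM => ?_, fun m hm hmt i hi hiM => ?_⟩
  · rw [ContentPush.Params.outageProb_one hΦ hlam hα hρ hε1 hβ hn hnt,
      ContentPush.Params.tau₂_eq hρ hε1, hΦ.real_lt_nearestDist hlam (by positivity),
      ContentPush.poissonLower_mul_rpow _ _ (by positivity)]
  · have hφ := ContentPush.Params.phi_pos hR hξ hi hiM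
    rw [ContentPush.Params.outageProb_self hΦ hlam hα hρ hR hβ hξ ht hi hiM,
      hΦ.real_lt_nearestDist hlam (by positivity),
      ContentPush.poissonLower_mul_rpow _ _ (by positivity)]
    have e : ∀ s : ℝ, (1 / (p.ε 1 / p.ρ + (1 + p.ε 1) / (p.ρ * p.phi i))) ^ s =
        (p.ε 1 / p.ρ + (1 + p.ε 1) / (p.ρ * p.phi i)) ^ (-s) := fun s => by
      rw [one_div, Real.inv_rpow (by positivity), Real.rpow_neg (by positivity)]
    simp only [e]
  · have hφ := ContentPush.Params.phi_pos hR hξ hi hiM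
    have h12 := ContentPush.Params.tau₁_le_tau₂ hα hρ hε1 hφ
    obtain ⟨k, rfl⟩ : ∃ k, m = k + 1 := ⟨m - 1, by omega⟩
    -- Here r = t - m - 1, the degree of the binomial expansion.
    obtain ⟨r, ht⟩ : ∃ r, p.t = k + r + 2 := ⟨p.t - k - 2, by omega⟩
    have hcont := fun q => ContentPush.Params.continuousOn_fm hα hρ hε1 hφ lam (k + 1) q
    have hII : ∀ q, IntervalIntegrable (p.fm lam (k + 1) i q) volume (p.tau₁ i) p.tau₂ :=
      fun q => (hcont q).intervalIntegrable_of_Icc h12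
    have h1 : p.outageProb P Φ (k + 1) i = p.outageProb P Φ p.t 1 +
        ∫ y in (p.tau₁ i)..p.tau₂, ∫ x in (p.g i y)..y, p.jointPdf lam (k + 1) x y := by
      rw [ContentPush.Params.outageProb_eq_add_measure hΦ hlam hα hρ hR hβ hξ ht hi hiM,
        ContentPush.Params.jointMeasure_real_eq_integral hlam hα hρ hε1 hφ ht]
    have h2 : p.outageProb P Φ (k + 1) i = p.outageProb P Φ p.t 1 +
        4 * (lam * Real.pi) ^ p.t / (((p.t - (k + 1) - 1)! : ℝ) * ((k + 1 - 1)! : ℝ)) *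
          ∑ q ∈ Finset.range (p.t - (k + 1)),
            (-1 : ℝ) ^ q * ((p.t - (k + 1) - 1).choose q : ℝ) *
              ∫ y in (p.tau₁ i)..p.tau₂, p.fm lam (k + 1) i q y := by
      rw [h1, show p.t - (k + 1) - 1 = r by omega, show p.t - (k + 1) = r + 1 by omega,
        Nat.add_sub_cancel]
      simp only [ContentPush.Params.integral_jointPdf_eq_sum_fm lam ht]
      rw [intervalIntegral.integral_const_mul, intervalIntegral.integral_finsetSum
        fun q _ => (hII q).const_mul _]
      simp only [intervalIntegral.integral_const_mul]
    refine ⟨h1, fun q _ => hII q, h2, ?_⟩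
    rw [h2]
    exact tendsto_const_nhds.add ((tendsto_finsetSum _ fun q _ =>
      (ContentPush.tendsto_chebGauss h12 (hcont q)).const_mul _).const_mul _)
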